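/- Let $n\in\mathbb{N}$ and $0<T<\infty$. Equip $\mathbb{R}^n$ with $\|x\|_n=\sum_i|x_i|$ and real $n\times n$ matrices with $\|A\|_{n\times n}=\max_i\sum_j|a_{ij}|$. Let $G[0,T]$ be the Banach space of regulated functions $x:[0,T]\to\mathbb{R}^n$ (functions having finite one-sided limits) with the norm $\|x\|_\infty=\sup_t\|x(t)\|_n$, and let $B(x_0,\rho)$ be the closed ball in $G[0,T]$. Write $\int_a^b DU(\tau,t)$ for the Kurzweil integral, i.e. the element $I$ such that for every $\varepsilon>0$ there is a gauge $\delta:[a,b]\to(0,\infty)$ with $\|\sum_j[U(\tau_j,t_j)-U(\tau_j,t_{j-1})]-I\|<\varepsilon$ for all tagged partitions $a=t_0\le\dots\le t_\nu=b$, $\tau_j\in[t_{j-1},t_j]$, satisfying $[t_{j-1},t_j]\subset(\tau_j-\delta(\tau_j),\tau_j+\delta(\tau_j))$ for all $j$. For $h:[0,T]\to\mathbb{R}$ nondecreasing and $\omega:[0,\infty)\to[0,\infty)$ increasing and continuous with $\omega(0)=0$, let $\mathcal{F}(\Omega\times[0,T],h,\omega;X)$ be the set of functions $f:\Omega\times[0,T]\to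 X$ with $$\|f(x,t_2)-f(x,t_1)\|\le|h(t_2)-h(t_1)|,\qquad \|f(x,t_2)-f(x,t_1)-f(y,t_2)+f(y,t_1)\|\le\omega(\|x-y\|_n)\,|h(t_2)-h(t_1)|$$ for all $x,y\in\Omega$, $t_1,t_2\in[0,T]$. Let $\Omega\subset\mathbb{R}^n$ and $\Lambda\subset\mathbb{R}$ be open, $F:\Lambda\times\Omega\times[0,T]\to\mathbb{R}^n$, $x_0\in G[0,T]$ and $\rho>0$, and assume: (B1) there are $h$, $\omega$ as above such that $F(\lambda,\cdot,\cdot)\in\mathcal{F}(\Omega\times[0,T],h,\omega;\mathbb{R}^n)$ for every $\lambda\in\Lambda$; (B2) for every $\lambda\in\Lambda$, $x_0(s)\in\Omega$ and $x_0(s)=x_0(0)+\int_0^s DF(\lambda,x_0(\tau),t)$ for all $s\in[0,T]$, and $x_0(0)=x_0(T)$; moreover $x(t)\in\Omega$ for all $t\in[0,T]$ and $x\in B(x_0,\rho)$; (B3) there is a nondecreasing $\gamma:[0,T]\to\mathbb{R}$ such that for every $\varepsilon>0$ there is $\delta>0$ with $$\|F(\lambda_1,x,t)-F(\lambda_2,x,t)-F(\lambda_1,x,s)+F(\lambda_2,x,s)\|_n\le\varepsilon\,|\gamma(t)-\gamma(s)|$$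 for all $x\in\Omega$, $t,s\in[0,T]$ and $\lambda_1,\lambda_2\in\Lambda$ with $|\lambda_1-\lambda_2|<\delta$; (C1) the derivative (Jacobian matrix) $F'_x(\lambda,x,t)$ exists for all $(\lambda,x,t)\in\Lambda\times\Omega\times[0,T]$, is continuous in $x\in\Omega$ for each $(\lambda,t)$, and there are $\widetilde h:[0,T]\to[0,\infty)$ nondecreasing and $\widetilde\omega:[0,\infty)\to[0,\infty)$ increasing and continuous with $\widetilde\omega(0)=0$ such that $F'_x(\lambda,\cdot,\cdot)\in\mathcal{F}(\Omega\times[0,T],\widetilde h,\widetilde\omega;\mathbb{R}^{n\times n})$ for every $\lambda\in\Lambda$; (C3) there is a nondecreasing $\widetilde\gamma:[0,T]\to\mathbb{R}$ such that for every $\varepsilon>0$ there is $\delta>0$ with $$\|F'_x(\lambda_1,x,t)-F'_x(\lambda_2,x,t)-F'_x(\lambda_1,x,s)+F'_x(\lambda_2,x,s)\|_{n\times n}\le\varepsilon\,|\widetilde\gamma(t)-\widetilde\gamma(s)|$$ for all $x\in\Omega$, $t,s\in[0,T]$ and $\lambda_1,\lambda_2\in\Lambda$ with $|\lambda_1-\lambda_2|<\delta$.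 For $\lambda\in\Lambda$ and $x\in B(x_0,\rho)$ define $\Phi(\lambda,x)\in G[0,T]$ by $\Phi(\lambda,x)(s)=x(T)+\int_0^s DF(\lambda,x(\tau),t)$, $s\in[0,T]$. A pair $(y,\mu)\in B(x_0,\rho)\times\Lambda$ with $y=\Phi(\mu,y)$ is called a bifurcation point of the equation $x=\Phi(\lambda,x)$ if every neighborhood of $(y,\mu)$ in $B(x_0,\rho)\times\Lambda$ contains a pair $(x,\lambda)$ with $x=\Phi(\lambda,x)$ and $x\ne y$. Let $\lambda_0\in\Lambda$ and suppose that $\mathrm{Id}-\Phi'_x(\lambda_0,x_0)$ is an isomorphism of $G[0,T]$ onto $G[0,T]$, where $\Phi'_x(\lambda_0,x_0)$ is the Fréchet derivative of $\Phi(\lambda_0,\cdot)$ at $x_0$. Then there is $\delta>0$ such that no $(x,\lambda)\in G[0,T]\times\mathbb{R}$ with $\|x-x_0\|_\infty+|\lambda-\lambda_0|<\delta$ is a bifurcation point of the equation $x=\Phi(\lambda,x)$. -/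

import Mathlib

open Set Filter Topology

attribute [local instance] Matrix.linftyOpNormedAddCommGroup

noncomputable section

namespace GenODE

/-! ### The Kurzweil integral -/

/-- `t 0 ≤ τ 0 ≤ t 1 ≤ τ 1 ≤ ⋯ ≤ t ν` is a tagged partition of `[a, b]` with `ν` subintervals
`[t j, t (j + 1)]` and tags `τ j` (`j < ν`); the values of the sequences beyond that are ignored. -/
def IsTaggedPartition (a b : ℝ) (ν : ℕ) (t τ : ℕ → ℝ) : Prop :=
  t 0 = a ∧ t ν = b ∧ ∀ j < ν, t j ≤ t (j + 1) ∧ τ j ∈ Icc (t j) (t (j + 1))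

/-- `δ`-fineness of a tagged partition. -/
def IsFine (δ : ℝ → ℝ) (ν : ℕ) (t τ : ℕ → ℝ) : Prop :=
  ∀ j < ν, Icc (t j) (t (j + 1)) ⊆ Ioo (τ j - δ (τ j)) (τ j + δ (τ j))

/-- `I` is the Kurzweil integral `∫_a^b DU(τ, t)`, for `a ≤ b`. -/
def HasKurzweilIntegral {X : Type*} [NormedAddCommGroup X]
    (U : ℝ → ℝ → X) (a b : ℝ) (I : X) : Prop :=
  ∀ ε > 0, ∃ δ : ℝ → ℝ, (∀ s ∈ Icc a b, 0 < δ s) ∧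
    ∀ (ν : ℕ) (t τ : ℕ → ℝ), IsTaggedPartition a b ν t τ → IsFine δ ν t τ →
      ‖(∑ j ∈ Finset.range ν, (U (τ j) (t (j + 1)) - U (τ j) (t j))) - I‖ < ε

open Classical in
/-- The value of the Kurzweil integral `∫_a^b DU(τ, t)`, for `a ≤ b`
(and `0` if it does not exist). -/
def kurzweilIntegral {X : Type*} [NormedAddCommGroup X] (U : ℝ → ℝ → X) (a b : ℝ) : X :=
  if h : ∃ I, HasKurzweilIntegral U a b I then h.choose else 0

/-! ### Regulated functions -/

/-- `f` is regulated on `[a, b]`. -/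
def IsRegulated {X : Type*} [NormedAddCommGroup X] (f : ℝ → X) (a b : ℝ) : Prop :=
  (∀ t ∈ Ioc a b, ∃ l, Tendsto f (𝓝[<] t) (𝓝 l)) ∧
    ∀ s ∈ Ico a b, ∃ l, Tendsto f (𝓝[>] s) (𝓝 l)

theorem IsRegulated.congr {X : Type*} [NormedAddCommGroup X] {f g : ℝ → X} {a b : ℝ}
    (hf : IsRegulated f a b) (h : ∀ t ∈ Icc a b, f t = g t) : IsRegulated g a b := by
  refine ⟨fun t ht => ?_, fun t ht => ?_⟩
  · obtain ⟨l, hl⟩ := hf.1 t ht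
    refine ⟨l, hl.congr' ?_⟩
    filter_upwards [Ioo_mem_nhdsLT ht.1] with u hu
    exact h u ⟨hu.1.le, hu.2.le.trans ht.2⟩
  · obtain ⟨l, hl⟩ := hf.2 t ht
    refine ⟨l, hl.congr' ?_⟩
    filter_upwards [Ioo_mem_nhdsGT ht.2] with u hu
    exact h u ⟨ht.1.trans hu.1.le, hu.2.le⟩

/-- A regulated function on a compact interval is bounded. -/
theorem IsRegulated.bounded {X : Type*} [NormedAddCommGroup X] {f : ℝ → X} {a b : ℝ}
    (hf : IsRegulated f a b) : ∃ C, ∀ t ∈ Icc a b, ‖f t‖ ≤ C := by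
  refine isCompact_Icc.induction_on (p := fun S => ∃ C, ∀ t ∈ S, ‖f t‖ ≤ C)
    ⟨0, by simp⟩ (fun s t hst ⟨C, hC⟩ => ⟨C, fun u hu => hC u (hst hu)⟩) ?_ ?_
  · rintro s t ⟨C, hC⟩ ⟨D, hD⟩
    refine ⟨max C D, ?_⟩
    rintro u (hu | hu)
    · exact (hC u hu).trans (le_max_left _ _)
    · exact (hD u hu).trans (le_max_right _ _)
  · intro t ht
    have key : ∀ l : Filter ℝ, (∃ y, Tendsto f l (𝓝 y)) → ∃ C, ∀ᶠ u in l, ‖f u‖ ≤ C := by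
      rintro l ⟨y, hy⟩
      exact ⟨‖y‖ + 1, hy.norm.eventually (eventually_le_nhds (by linarith))⟩
    have hL : ∃ C, ∀ᶠ u in 𝓝[<] t, u ∈ Icc a b → ‖f u‖ ≤ C := by
      rcases ht.1.eq_or_lt with h | h
      · refine ⟨0, ?_⟩
        filter_upwards [self_mem_nhdsWithin] with u hu hu'
        exact absurd hu'.1 (by rw [h]; exact not_le.2 hu)
      · obtain ⟨C, hC⟩ := key _ (hf.1 t ⟨h, ht.2⟩)
        exact ⟨C, hC.mono fun u hu _ => hu⟩
    have hR : ∃ C, ∀ᶠ u in 𝓝[>] t, u ∈ Icc a b → ‖f u‖ ≤ C := by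
      rcases ht.2.eq_or_lt with h | h
      · refine ⟨0, ?_⟩
        filter_upwards [self_mem_nhdsWithin] with u hu hu'
        exact absurd hu'.2 (by rw [← h]; exact not_le.2 hu)
      · obtain ⟨C, hC⟩ := key _ (hf.2 t ⟨ht.1, h⟩)
        exact ⟨C, hC.mono fun u hu _ => hu⟩
    obtain ⟨C, hC⟩ := hL
    obtain ⟨D, hD⟩ := hR
    refine ⟨_, inter_mem_nhdsWithin (Icc a b)
      (t := {u | u ∈ Icc a b → ‖f u‖ ≤ max (max C D) ‖f t‖}) ?_, max (max C D) ‖f t‖,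
      fun u hu => hu.2 hu.1⟩
    rw [← nhdsNE_sup_pure, ← nhdsLT_sup_nhdsGT]
    refine ⟨⟨?_, ?_⟩, ?_⟩
    · filter_upwards [hC] with u hu hu'
      exact (hu hu').trans ((le_max_left _ _).trans (le_max_left _ _))
    · filter_upwards [hD] with u hu hu'
      exact (hu hu').trans ((le_max_right _ _).trans (le_max_left _ _))
    · exact fun _ => le_max_right _ _

/-- `ℝⁿ` with the norm `∑ |xᵢ|`. -/
abbrev E (n : ℕ) : Type := PiLp 1 (fun _ : Fin n => ℝ)

/-- Bounded functions `[0, T] → ℝⁿ` with the supremum norm. -/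
abbrev Bdd (n : ℕ) (T : ℝ) : Type :=
  lp (fun _ : Icc (0 : ℝ) T => E n) ⊤

open Classical in
/-- Extension by `0` of a function on `[0, T]`, so that it can be evaluated at real numbers. -/
def ext0 {X : Type*} [Zero X] {T : ℝ} (f : Icc (0 : ℝ) T → X) (t : ℝ) : X :=
  if h : t ∈ Icc (0 : ℝ) T then f ⟨t, h⟩ else 0

/-- The space `G[0, T]` of regulated functions `[0, T] → ℝⁿ` with the supremum norm
(every regulated function is bounded, by `IsRegulated.bounded`). -/
def regulatedSubmodule (n : ℕ) (T : ℝ) : Submodule ℝ (Bdd n T) where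
  carrier := {f | IsRegulated (ext0 (f : Icc (0 : ℝ) T → E n)) 0 T}
  zero_mem' := by
    have h : ext0 ((0 : Bdd n T) : Icc (0 : ℝ) T → E n) = fun _ => 0 := by
      funext t
      simp [ext0]
    rw [mem_ofPred_eq, h]
    exact ⟨fun _ _ => ⟨0, tendsto_const_nhds⟩, fun _ _ => ⟨0, tendsto_const_nhds⟩⟩
  add_mem' := by
    intro f g hf hg
    have h : ext0 ((f + g : Bdd n T) : Icc (0 : ℝ) T → E n) = fun t =>
        ext0 (f : Icc (0 : ℝ) T → E n) t + ext0 (g : Icc (0 : ℝ) T → E n) t := by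
      funext t
      by_cases ht : t ∈ Icc (0 : ℝ) T <;> simp [ext0, ht]
    rw [mem_ofPred_eq, h]
    refine ⟨fun t ht => ?_, fun t ht => ?_⟩
    · obtain ⟨l, hl⟩ := hf.1 t ht
      obtain ⟨m, hm⟩ := hg.1 t ht
      exact ⟨l + m, hl.add hm⟩
    · obtain ⟨l, hl⟩ := hf.2 t ht
      obtain ⟨m, hm⟩ := hg.2 t ht
      exact ⟨l + m, hl.add hm⟩
  smul_mem' := by
    intro c f hf
    have h : ext0 ((c • f : Bdd n T) : Icc (0 : ℝ) T → E n) = fun t =>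
        c • ext0 (f : Icc (0 : ℝ) T → E n) t := by
      funext t
      by_cases ht : t ∈ Icc (0 : ℝ) T <;> simp [ext0, ht]
    rw [mem_ofPred_eq, h]
    refine ⟨fun t ht => ?_, fun t ht => ?_⟩
    · obtain ⟨l, hl⟩ := hf.1 t ht
      exact ⟨c • l, hl.const_smul c⟩
    · obtain ⟨l, hl⟩ := hf.2 t ht
      exact ⟨c • l, hl.const_smul c⟩

/-- The normed space `G[0, T]`. -/
abbrev G (n : ℕ) (T : ℝ) : Type := regulatedSubmodule n T

/-- The value `x(t)`, for `t ∈ [0, T]`. -/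
def ev {n : ℕ} {T : ℝ} (x : G n T) (t : ℝ) : E n :=
  ext0 ((x : Bdd n T) : Icc (0 : ℝ) T → E n) t

/-- A regulated function on `[0, T]` as an element of `G[0, T]`. -/
def mkG {n : ℕ} {T : ℝ} (f : ℝ → E n) (hf : IsRegulated f 0 T) : G n T :=
  ⟨⟨fun t => f t, by
      obtain ⟨C, hC⟩ := hf.bounded
      refine memℓp_infty ⟨C, ?_⟩
      rintro _ ⟨t, rfl⟩
      exact hC t t.2⟩,
    hf.congr fun t ht => by simp only [ext0, dif_pos ht]⟩

/-! ### The periodic problem and its operator -/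

/-- `(x, lam)` solves `dx/dτ = DF(lam, x, t)`, `x(0) = x(T)`. -/
def IsPeriodicSolution {n : ℕ} {T : ℝ} (F : ℝ → E n → ℝ → E n) (Ω : Set (E n))
    (x : G n T) (lam : ℝ) : Prop :=
  (∀ s ∈ Icc 0 T, ev x s ∈ Ω ∧
    HasKurzweilIntegral (fun τ t => F lam (ev x τ) t) 0 s (ev x s - ev x 0)) ∧
  ev x 0 = ev x T

/-- `Φ(lam, x)(s) = x(T) + ∫_0^s DF(lam, x(τ), t)`. -/
def PhiFun {n : ℕ} {T : ℝ} (F : ℝ → E n → ℝ → E n) (lam : ℝ) (x : G n T) (s : ℝ) : E n :=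
  ev x T + kurzweilIntegral (fun τ t => F lam (ev x τ) t) 0 s

open Classical in
/-- The operator `Φ(lam, ·)` with values in `G[0, T]` (with value `0` where the function above is
not regulated). -/
def Phi {n : ℕ} {T : ℝ} (F : ℝ → E n → ℝ → E n) (lam : ℝ) (x : G n T) : G n T :=
  if h : IsRegulated (PhiFun F lam x) 0 T then mkG (PhiFun F lam x) h else 0

/-- `(x, lam) ∈ B(x₀, ρ) × Λ` satisfies `x = Φ(lam, x)`. -/
def SolvesOp {n : ℕ} {T : ℝ} (F : ℝ → E n → ℝ → E n) (Λ : Set ℝ) (x₀ : G n T) (ρ : ℝ)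
    (x : G n T) (lam : ℝ) : Prop :=
  x ∈ Metric.closedBall x₀ ρ ∧ lam ∈ Λ ∧ x = Phi F lam x

/-- `(y, μ)` is a bifurcation point of the equation `x = Φ(lam, x)` on `B(x₀, ρ) × Λ`. -/
def IsBifurcationPoint {n : ℕ} {T : ℝ} (F : ℝ → E n → ℝ → E n) (Λ : Set ℝ) (x₀ : G n T) (ρ : ℝ)
    (y : G n T) (μ : ℝ) : Prop :=
  SolvesOp F Λ x₀ ρ y μ ∧
    ∀ U ∈ 𝓝 (y, μ), ∃ x lam, (x, lam) ∈ U ∧ SolvesOp F Λ x₀ ρ x lam ∧ x ≠ y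

/-! ### Hypotheses on the right-hand side -/

/-- `ω : [0, ∞) → [0, ∞)` is increasing and continuous with `ω(0) = 0`. -/
def IsModulus (ω : ℝ → ℝ) : Prop :=
  StrictMonoOn ω (Ici 0) ∧ ContinuousOn ω (Ici 0) ∧ ω 0 = 0

/-- The class `𝓕(Ω × [0, T], h, ω; X)`. -/
def ClassF {V X : Type*} [NormedAddCommGroup V] [NormedAddCommGroup X]
    (Ω : Set V) (T : ℝ) (h ω : ℝ → ℝ) (f : V → ℝ → X) : Prop :=
  (∀ x ∈ Ω, ∀ t₁ ∈ Icc 0 T, ∀ t₂ ∈ Icc 0 T, ‖f x t₂ - f x t₁‖ ≤ |h t₂ - h t₁|) ∧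
  ∀ x ∈ Ω, ∀ y ∈ Ω, ∀ t₁ ∈ Icc 0 T, ∀ t₂ ∈ Icc 0 T,
    ‖f x t₂ - f x t₁ - f y t₂ + f y t₁‖ ≤ ω ‖x - y‖ * |h t₂ - h t₁|

/-- Increments of `f(lam, x, ·)` depend on `lam` uniformly continuously, relative to a
nondecreasing function `γ`. -/
def UniformInParameter {V X : Type*} [NormedAddCommGroup V] [NormedAddCommGroup X]
    (Λ : Set ℝ) (Ω : Set V) (T : ℝ) (f : ℝ → V → ℝ → X) : Prop :=
  ∃ γ : ℝ → ℝ, MonotoneOn γ (Icc 0 T) ∧ ∀ ε > 0, ∃ δ > 0,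
    ∀ x ∈ Ω, ∀ t ∈ Icc 0 T, ∀ s ∈ Icc 0 T, ∀ l₁ ∈ Λ, ∀ l₂ ∈ Λ, |l₁ - l₂| < δ →
      ‖f l₁ x t - f l₂ x t - f l₁ x s + f l₂ x s‖ ≤ ε * |γ t - γ s|

/-- The Jacobian matrix `F'_x(lam, x, t)`. Matrices carry the norm `max_i ∑_j |a_{ij}|`. -/
def jacobian {n : ℕ} (F : ℝ → E n → ℝ → E n) (lam : ℝ) (x : E n) (t : ℝ) :
    Matrix (Fin n) (Fin n) ℝ :=
  LinearMap.toMatrix (PiLp.basisFun 1 ℝ (Fin n)) (PiLp.basisFun 1 ℝ (Fin n))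
    (fderiv ℝ (fun y => F lam y t) x).toLinearMap

/-- `F(lam, ·, ·)` lies in one class `𝓕(Ω × [0, T], h, ω)` for all `lam ∈ Λ`. -/
def CondB1 {n : ℕ} (T : ℝ) (Λ : Set ℝ) (Ω : Set (E n)) (F : ℝ → E n → ℝ → E n) : Prop :=
  IsOpen Ω ∧ IsOpen Λ ∧ ∃ h ω : ℝ → ℝ, MonotoneOn h (Icc 0 T) ∧ IsModulus ω ∧
    ∀ lam ∈ Λ, ClassF Ω T h ω (F lam)

/-- `x₀` solves the periodic problem for every `lam ∈ Λ`, and all functions in `B(x₀, ρ)` have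
their values in `Ω`. -/
def CondB2 {n : ℕ} {T : ℝ} (Λ : Set ℝ) (Ω : Set (E n)) (F : ℝ → E n → ℝ → E n)
    (x₀ : G n T) (ρ : ℝ) : Prop :=
  (∀ lam ∈ Λ, IsPeriodicSolution F Ω x₀ lam) ∧ 0 < ρ ∧
    ∀ t ∈ Icc 0 T, ∀ x ∈ Metric.closedBall x₀ ρ, ev x t ∈ Ω

/-- Uniform continuity of `F` in the parameter. -/
def CondB3 {n : ℕ} (T : ℝ) (Λ : Set ℝ) (Ω : Set (E n)) (F : ℝ → E n → ℝ → E n) : Prop :=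
  UniformInParameter Λ Ω T F

/-- `F'_x` exists, is continuous in `x`, and lies in one class `𝓕(Ω × [0, T], h, ω; ℝⁿˣⁿ)` for all
`lam ∈ Λ`. -/
def CondC1 {n : ℕ} (T : ℝ) (Λ : Set ℝ) (Ω : Set (E n)) (F : ℝ → E n → ℝ → E n) : Prop :=
  (∀ lam ∈ Λ, ∀ x ∈ Ω, ∀ t ∈ Icc 0 T, DifferentiableAt ℝ (fun y => F lam y t) x) ∧
  (∀ lam ∈ Λ, ∀ t ∈ Icc 0 T, ContinuousOn (fun x => jacobian F lam x t) Ω) ∧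
  ∃ h ω : ℝ → ℝ, MonotoneOn h (Icc 0 T) ∧ (∀ t ∈ Icc 0 T, 0 ≤ h t) ∧ IsModulus ω ∧
    ∀ lam ∈ Λ, ClassF Ω T h ω (jacobian F lam)

/-- Uniform continuity of `F'_x` in the parameter. -/
def CondC3 {n : ℕ} (T : ℝ) (Λ : Set ℝ) (Ω : Set (E n)) (F : ℝ → E n → ℝ → E n) : Prop :=
  UniformInParameter Λ Ω T (jacobian F)

end GenODE

end

/-!
Since `x₀ = Φ(λ, x₀)` for every `λ`, it suffices that `x₀` is the only solution of `x = Φ(λ, x)` for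
`(x, λ)` near `(x₀, λ₀)`. Let `A_λ z (s) = z(T) + ∫_0^s D[F'_x(λ, x₀(τ), t) z(τ)]`. The mean value
inequality under the integral sign bounds `Φ(λ, x) - x₀ - A_λ (x - x₀)` by a constant times
`ω'(‖x - x₀‖) ‖x - x₀‖`, uniformly in `λ`, where `ω'` is the modulus of continuity of `F'_x`, and
`A_λ → A_{λ₀}` in operator norm by (C3). Hence
`Φ(λ, x) - x₀ - A_{λ₀} (x - x₀) = o(‖x - x₀‖)` as `(x, λ) → (x₀, λ₀)`. In particular
`A_{λ₀} = Φ'_x(λ₀, x₀)`, and a solution `x` satisfies `(Id - A_{λ₀}) (x - x₀) = o(‖x - x₀‖)`, so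
that `x = x₀` when `Id - A_{λ₀}` is an isomorphism.

The integrals exist because the integrands are, near every point and off that point, almost
independent of the tag: this gives local primitives up to small errors, which are glued by
induction along the interval.
-/

namespace GenODE

theorem interval_induction {a b : ℝ} (hab : a ≤ b) {P : ℝ → ℝ → Prop} (hrefl : P a a)
    (htrans : ∀ m ∈ Icc a b, ∀ d ∈ Icc m b, P a m → P m d → P a d)
    (hleft : ∀ τ ∈ Ioc a b, ∀ᶠ c in 𝓝[<] τ, P c τ)
    (hright : ∀ τ ∈ Ico a b, ∀ᶠ d in 𝓝[>] τ, P τ d) : P a b := by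
  let S : Set ℝ := {s | s ∈ Icc a b ∧ P a s}
  have haS : a ∈ S := ⟨left_mem_Icc.2 hab, hrefl⟩
  obtain ⟨c, hlub⟩ : ∃ c, IsLUB S c := ⟨_, isLUB_csSup ⟨a, haS⟩ ⟨b, fun s hs => hs.1.2⟩⟩
  have hc : c ∈ Icc a b := ⟨hlub.1 haS, hlub.2 fun s hs => hs.1.2⟩
  have hcS : c ∈ S := by
    by_contra hcS
    have hac : a < c := hc.1.lt_of_ne fun h => hcS (h ▸ haS)
    obtain ⟨l, hl, hlc⟩ := (mem_nhdsLT_iff_exists_Ioo_subset' hac).1 (hleft c ⟨hac, hc.2⟩)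
    obtain ⟨s, hs, hls, hsc⟩ := hlub.exists_between' hcS hl
    exact hcS ⟨hc, htrans s hs.1 c ⟨hsc.le, hc.2⟩ hs.2 (hlc ⟨hls, hsc⟩)⟩
  rcases hc.2.eq_or_lt with rfl | hcb
  · exact hcS.2
  · obtain ⟨d, hPd, hcd, hdb⟩ := ((hright c ⟨hc.1, hcb⟩).and (Ioo_mem_nhdsGT hcb)).exists
    have hdS : d ∈ S := ⟨⟨hc.1.trans hcd.le, hdb.le⟩, htrans c hc d ⟨hcd.le, hdb.le⟩ hcS.2 hPd⟩
    exact absurd (hlub.1 hdS) hcd.not_ge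

/-! ### The Kurzweil integral as a limit of Riemann sums -/

/-- The data of a tagged partition: the number of subintervals, the division points and the
tags. -/
structure Division where
  size : ℕ
  node : ℕ → ℝ
  tag : ℕ → ℝ

namespace Division

/-- `p` is a `δ`-fine tagged partition of `[a, b]`. -/
def IsFineOn (δ : ℝ → ℝ) (a b : ℝ) (p : Division) : Prop :=
  IsTaggedPartition a b p.size p.node p.tag ∧ IsFine δ p.size p.node p.tag

/-- The tagged partition with the single subinterval `[c, d]` and the tag `τ`. -/
def single (c τ d : ℝ) : Division where
  size := 1
  node j := if j = 0 then c else d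
  tag _ := τ

/-- The concatenation of a tagged partition of `[a, m]` with one of `[m, b]`. -/
def append (p q : Division) : Division where
  size := p.size + q.size
  node j := if j < p.size then p.node j else q.node (j - p.size)
  tag j := if j < p.size then p.tag j else q.tag (j - p.size)

/-- The Riemann sum of `∫ DU(τ, t)`. -/
def riemannSum {X : Type*} [AddCommGroup X] (U : ℝ → ℝ → X) (p : Division) : X :=
  ∑ j ∈ Finset.range p.size, (U (p.tag j) (p.node (j + 1)) - U (p.tag j) (p.node j))

variable {a b m : ℝ} {δ : ℝ → ℝ} {p q : Division}

theorem isFineOn_single {c τ d : ℝ} (hτ : τ ∈ Icc c d)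
    (hδ : Icc c d ⊆ Ioo (τ - δ τ) (τ + δ τ)) : (single c τ d).IsFineOn δ c d := by
  refine ⟨⟨rfl, rfl, fun j hj => ?_⟩, fun j hj => ?_⟩
  all_goals obtain rfl : j = 0 := Nat.lt_one_iff.1 hj
  · exact ⟨hτ.1.trans hτ.2, hτ⟩
  · exact hδ

theorem node_append_add (i : ℕ) : (p.append q).node (p.size + i) = q.node i := by
  simp [append]

theorem tag_append_add (i : ℕ) : (p.append q).tag (p.size + i) = q.tag i := by
  simp [append]

theorem tag_append_of_lt {j : ℕ} (hj : j < p.size) : (p.append q).tag j = p.tag j :=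
  if_pos hj

theorem node_append_of_le (hpq : p.node p.size = q.node 0) {j : ℕ} (hj : j ≤ p.size) :
    (p.append q).node j = p.node j := by
  rcases hj.eq_or_lt with rfl | hj
  · simp [append, hpq]
  · exact if_pos hj

theorem IsFineOn.append (hp : p.IsFineOn δ a m) (hq : q.IsFineOn δ m b) :
    (p.append q).IsFineOn δ a b := by
  obtain ⟨⟨hp₀, hp₁, hp⟩, hpδ⟩ := hp
  obtain ⟨⟨hq₀, hq₁, hq⟩, hqδ⟩ := hq
  have hpq : p.node p.size = q.node 0 := hp₁.trans hq₀.symm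
  refine ⟨⟨(node_append_of_le hpq (Nat.zero_le _)).trans hp₀,
    (node_append_add _).trans hq₁, fun j hj => ?_⟩, fun j hj => ?_⟩
  all_goals rcases lt_or_ge j p.size with hjp | hjp
  · rw [node_append_of_le hpq hjp.le, node_append_of_le hpq hjp, tag_append_of_lt hjp]
    exact hp j hjp
  · obtain ⟨i, rfl⟩ := Nat.exists_eq_add_of_le hjp
    rw [add_assoc, node_append_add, node_append_add, tag_append_add]
    exact hq i (Nat.add_lt_add_iff_left.1 hj)
  · rw [node_append_of_le hpq hjp.le, node_append_of_le hpq hjp, tag_append_of_lt hjp]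
    exact hpδ j hjp
  · obtain ⟨i, rfl⟩ := Nat.exists_eq_add_of_le hjp
    rw [add_assoc, node_append_add, node_append_add, tag_append_add]
    exact hqδ i (Nat.add_lt_add_iff_left.1 hj)

theorem riemannSum_append {X : Type*} [AddCommGroup X] (U : ℝ → ℝ → X)
    (hpq : p.node p.size = q.node 0) :
    (p.append q).riemannSum U = p.riemannSum U + q.riemannSum U := by
  refine (Finset.sum_range_add _ _ _).trans (congrArg₂ _ ?_ ?_)
  · refine Finset.sum_congr rfl fun j hj => ?_
    have hj : j < p.size := Finset.mem_range.1 hj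
    rw [node_append_of_le hpq hj.le, node_append_of_le hpq hj, tag_append_of_lt hj]
  · refine Finset.sum_congr rfl fun i _ => ?_
    rw [add_assoc, node_append_add, node_append_add, tag_append_add]

theorem IsFineOn.node_mem_Icc (hp : p.IsFineOn δ a b) {j : ℕ} (hj : j ≤ p.size) :
    p.node j ∈ Icc a b := by
  obtain ⟨⟨rfl, rfl, hp⟩, -⟩ := hp
  have hmono : MonotoneOn p.node (Iic p.size) :=
    monotoneOn_of_le_succ ordConnected_Iic fun j _ _ hj => (hp j hj).1
  exact ⟨hmono (Nat.zero_le _) hj (Nat.zero_le _), hmono hj self_mem_Iic hj⟩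

/-- Cousin's lemma. -/
theorem exists_isFineOn (hab : a ≤ b) (hδ : ∀ s ∈ Icc a b, 0 < δ s) :
    ∃ p : Division, p.IsFineOn δ a b := by
  refine interval_induction hab (P := fun c d => ∃ p : Division, p.IsFineOn δ c d)
    ⟨_, isFineOn_single (left_mem_Icc.2 le_rfl) ?_⟩
    (fun m _ d _ ⟨p, hp⟩ ⟨q, hq⟩ => ⟨_, hp.append hq⟩) (fun τ hτ => ?_) (fun τ hτ => ?_)
  · have := hδ a (left_mem_Icc.2 hab)
    exact Icc_subset_Ioo (by linarith) (by linarith)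
  · have := hδ τ (Ioc_subset_Icc_self hτ)
    filter_upwards [Ioo_mem_nhdsLT (sub_lt_self τ this)] with c hc
    exact ⟨_, isFineOn_single (right_mem_Icc.2 hc.2.le) (Icc_subset_Ioo hc.1 (by linarith))⟩
  · have := hδ τ (Ico_subset_Icc_self hτ)
    filter_upwards [Ioo_mem_nhdsGT (lt_add_of_pos_right τ this)] with d hd
    exact ⟨_, isFineOn_single (left_mem_Icc.2 hd.1.le) (Icc_subset_Ioo (by linarith) hd.2)⟩

end Division

/-- The filter of tagged partitions of `[a, b]` along which Riemann sums converge to the Kurzweil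
integral: its basic sets consist of the `δ`-fine partitions, for gauges `δ` on `[a, b]`. -/
def divisions (a b : ℝ) : Filter Division :=
  ⨅ δ ∈ {δ : ℝ → ℝ | ∀ s ∈ Icc a b, 0 < δ s}, 𝓟 {p | p.IsFineOn δ a b}

section Divisions

variable {a b m : ℝ} {δ : ℝ → ℝ}

theorem hasBasis_divisions (a b : ℝ) :
    (divisions a b).HasBasis (fun δ => ∀ s ∈ Icc a b, 0 < δ s) fun δ => {p | p.IsFineOn δ a b} := by
  refine hasBasis_biInf_principal ?_ ⟨fun _ => 1, fun _ _ => one_pos⟩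
  intro δ₁ hδ₁ δ₂ hδ₂
  refine ⟨fun s => min (δ₁ s) (δ₂ s), fun s hs => lt_min (hδ₁ s hs) (hδ₂ s hs),
    fun p hp => ⟨hp.1, fun j hj => (hp.2 j hj).trans ?_⟩,
    fun p hp => ⟨hp.1, fun j hj => (hp.2 j hj).trans ?_⟩⟩
  · exact Ioo_subset_Ioo (sub_le_sub_left (min_le_left _ _) _)
      (add_le_add_right (min_le_left _ _) _)
  · exact Ioo_subset_Ioo (sub_le_sub_left (min_le_right _ _) _)
      (add_le_add_right (min_le_right _ _) _)

theorem eventually_isFineOn (hδ : ∀ s ∈ Icc a b, 0 < δ s) :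
    ∀ᶠ p in divisions a b, p.IsFineOn δ a b :=
  (hasBasis_divisions a b).mem_of_mem hδ

theorem divisions_neBot (hab : a ≤ b) : (divisions a b).NeBot :=
  (hasBasis_divisions a b).neBot_iff.2 fun hδ => Division.exists_isFineOn hab hδ

theorem tendsto_append (hm : m ∈ Icc a b) :
    Tendsto (fun p : Division × Division => p.1.append p.2) (divisions a m ×ˢ divisions m b)
      (divisions a b) := by
  refine (hasBasis_divisions a b).tendsto_right_iff.2 fun δ hδ => ?_
  filter_upwards [(eventually_isFineOn fun s hs => hδ s ⟨hs.1, hs.2.trans hm.2⟩).prod_mk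
    (eventually_isFineOn fun s hs => hδ s ⟨hm.1.trans hs.1, hs.2⟩)] with p hp
  exact hp.1.append hp.2

theorem eventually_riemannSum_append {X : Type*} [AddCommGroup X] (U : ℝ → ℝ → X) :
    ∀ᶠ p : Division × Division in divisions a m ×ˢ divisions m b,
      (p.1.append p.2).riemannSum U = p.1.riemannSum U + p.2.riemannSum U := by
  filter_upwards [(eventually_isFineOn (δ := fun _ => 1) fun _ _ => one_pos).prod_mk
    (eventually_isFineOn (δ := fun _ => 1) fun _ _ => one_pos)] with p hp
  exact Division.riemannSum_append U (hp.1.1.2.1.trans hp.2.1.1.symm)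

end Divisions

section KurzweilIntegral

variable {X : Type*} [NormedAddCommGroup X] {U V : ℝ → ℝ → X} {a b : ℝ} {I J : X}

theorem hasKurzweilIntegral_iff_tendsto :
    HasKurzweilIntegral U a b I ↔
      Tendsto (Division.riemannSum U) (divisions a b) (𝓝 I) := by
  rw [(hasBasis_divisions a b).tendsto_iff Metric.nhds_basis_ball]
  simp only [mem_ball_iff_norm]
  exact forall₂_congr fun ε _ => exists_congr fun δ => and_congr_right fun _ =>
    ⟨fun H p hp => H p.size p.node p.tag hp.1 hp.2, fun H ν t τ ht hδ => H ⟨ν, t, τ⟩ ⟨ht, hδ⟩⟩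

namespace HasKurzweilIntegral

theorem unique (hab : a ≤ b) (hI : HasKurzweilIntegral U a b I)
    (hJ : HasKurzweilIntegral U a b J) : I = J :=
  have := divisions_neBot hab
  tendsto_nhds_unique (hasKurzweilIntegral_iff_tendsto.1 hI)
    (hasKurzweilIntegral_iff_tendsto.1 hJ)

theorem kurzweilIntegral_eq (hab : a ≤ b) (hI : HasKurzweilIntegral U a b I) :
    kurzweilIntegral U a b = I := by
  have h : ∃ I, HasKurzweilIntegral U a b I := ⟨I, hI⟩
  rw [kurzweilIntegral, dif_pos h]
  exact h.choose_spec.unique hab hI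

theorem add (hI : HasKurzweilIntegral U a b I) (hJ : HasKurzweilIntegral V a b J) :
    HasKurzweilIntegral (fun τ t => U τ t + V τ t) a b (I + J) := by
  rw [hasKurzweilIntegral_iff_tendsto] at *
  refine (hI.add hJ).congr fun p => ?_
  simp only [Division.riemannSum, ← Finset.sum_add_distrib, add_sub_add_comm]

theorem sub (hI : HasKurzweilIntegral U a b I) (hJ : HasKurzweilIntegral V a b J) :
    HasKurzweilIntegral (fun τ t => U τ t - V τ t) a b (I - J) := by
  rw [hasKurzweilIntegral_iff_tendsto] at *
  refine (hI.sub hJ).congr fun p => ?_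
  simp only [Division.riemannSum, ← Finset.sum_sub_distrib, sub_sub_sub_comm]

theorem const_smul [NormedSpace ℝ X] (r : ℝ) (hI : HasKurzweilIntegral U a b I) :
    HasKurzweilIntegral (fun τ t => r • U τ t) a b (r • I) := by
  rw [hasKurzweilIntegral_iff_tendsto] at *
  refine (hI.const_smul r).congr fun p => ?_
  simp only [Division.riemannSum, Finset.smul_sum, smul_sub]

end HasKurzweilIntegral

/-- `I` is a primitive of `U` on `[a, b]` up to an error governed by the increments of `g`: to the
left and to the right of each point `τ`, the increments of `I` and of `U τ` differ by at most those
of `g`. -/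
structure IsApproxPrimitive (U : ℝ → ℝ → X) (I : ℝ → X) (g : ℝ → ℝ) (a b : ℝ) : Prop where
  left : ∀ τ ∈ Ioc a b, ∀ᶠ u in 𝓝[<] τ, ‖(I τ - I u) - (U τ τ - U τ u)‖ ≤ g τ - g u
  right : ∀ τ ∈ Ico a b, ∀ᶠ v in 𝓝[>] τ, ‖(I v - I τ) - (U τ v - U τ τ)‖ ≤ g v - g τ

namespace IsApproxPrimitive

variable {I : ℝ → X} {g : ℝ → ℝ}

theorem exists_gauge (hI : IsApproxPrimitive U I g a b) {τ : ℝ} (hτ : τ ∈ Icc a b) :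
    ∃ δ > 0, ∀ u ∈ Icc a τ, ∀ v ∈ Icc τ b, Icc u v ⊆ Ioo (τ - δ) (τ + δ) →
      ‖(I v - I u) - (U τ v - U τ u)‖ ≤ g v - g u := by
  have hleft : ∀ᶠ u in 𝓝 τ, u ∈ Icc a τ → ‖(I τ - I u) - (U τ τ - U τ u)‖ ≤ g τ - g u := by
    rcases hτ.1.eq_or_lt with rfl | haτ
    · exact .of_forall fun u hu => by simp [le_antisymm hu.2 hu.1]
    · filter_upwards [eventually_nhdsWithin_iff.1 (hI.left τ ⟨haτ, hτ.2⟩)] with u hu hmem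
      rcases hmem.2.eq_or_lt with rfl | hlt
      · simp
      · exact hu hlt
  have hright : ∀ᶠ v in 𝓝 τ, v ∈ Icc τ b → ‖(I v - I τ) - (U τ v - U τ τ)‖ ≤ g v - g τ := by
    rcases hτ.2.eq_or_lt with rfl | hτb
    · exact .of_forall fun v hv => by simp [le_antisymm hv.2 hv.1]
    · filter_upwards [eventually_nhdsWithin_iff.1 (hI.right τ ⟨hτ.1, hτb⟩)] with v hv hmem
      rcases hmem.1.eq_or_lt with rfl | hlt
      · simp
      · exact hv hlt
  obtain ⟨δ, hδ, hball⟩ := Metric.eventually_nhds_iff_ball.1 (hleft.and hright)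
  rw [Real.ball_eq_Ioo] at hball
  refine ⟨δ, hδ, fun u hu v hv huv => ?_⟩
  have huv' : u ≤ v := hu.2.trans hv.1
  calc ‖(I v - I u) - (U τ v - U τ u)‖
      = ‖((I τ - I u) - (U τ τ - U τ u)) + ((I v - I τ) - (U τ v - U τ τ))‖ := by congr 1; abel
    _ ≤ (g τ - g u) + (g v - g τ) :=
        norm_add_le_of_le ((hball u (huv (left_mem_Icc.2 huv'))).1 hu)
          ((hball v (huv (right_mem_Icc.2 huv'))).2 hv)
    _ = g v - g u := by ring

theorem eventually_norm_sub_riemannSum_le (hI : IsApproxPrimitive U I g a b) :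
    ∀ᶠ p in divisions a b, ‖(I b - I a) - p.riemannSum U‖ ≤ g b - g a := by
  choose! δ hδ hIδ using fun τ => hI.exists_gauge (τ := τ)
  filter_upwards [eventually_isFineOn hδ] with p hp
  obtain ⟨⟨hp₀, hp₁, hp'⟩, hpδ⟩ := id hp
  rw [← hp₀, ← hp₁, ← Finset.sum_range_sub (fun j => I (p.node j)),
    ← Finset.sum_range_sub (fun j => g (p.node j)), Division.riemannSum, ← Finset.sum_sub_distrib]
  refine norm_sum_le_of_le _ fun j hj => ?_
  have hj : j < p.size := Finset.mem_range.1 hj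
  have hu := hp.node_mem_Icc hj.le
  have hv := hp.node_mem_Icc (Nat.succ_le_of_lt hj)
  have hτ := (hp' j hj).2
  exact hIδ _ ⟨hu.1.trans hτ.1, hτ.2.trans hv.2⟩ _ ⟨hu.1, hτ.1⟩ _ ⟨hτ.2, hv.2⟩ (hpδ j hj)

end IsApproxPrimitive

/-- For each tag `τ ∈ [a, b]`, the increments of `U τ` over subintervals of `[a, b]` are at most
those of `k`. -/
def IncrementsLE (U : ℝ → ℝ → X) (k : ℝ → ℝ) (a b : ℝ) : Prop :=
  ∀ τ ∈ Icc a b, ∀ u ∈ Icc a b, ∀ v ∈ Icc a b, u ≤ v → ‖U τ v - U τ u‖ ≤ k v - k u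

section IncrementsLE

variable {k : ℝ → ℝ}

theorem IncrementsLE.mono {c d : ℝ} (hU : IncrementsLE U k a b) (hac : a ≤ c) (hdb : d ≤ b) :
    IncrementsLE U k c d := by
  have hsub := Icc_subset_Icc hac hdb
  exact fun τ hτ u hu v hv => hU τ (hsub hτ) u (hsub hu) v (hsub hv)

theorem IncrementsLE.isApproxPrimitive_zero (hU : IncrementsLE U k a b) :
    IsApproxPrimitive U 0 k a b where
  left τ hτ := by
    filter_upwards [Ioo_mem_nhdsLT hτ.1] with u hu
    simpa [norm_sub_rev] using hU τ (Ioc_subset_Icc_self hτ) u ⟨hu.1.le, hu.2.le.trans hτ.2⟩ τ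
      (Ioc_subset_Icc_self hτ) hu.2.le
  right τ hτ := by
    filter_upwards [Ioo_mem_nhdsGT hτ.2] with v hv
    simpa [norm_sub_rev] using hU τ (Ico_subset_Icc_self hτ) τ (Ico_subset_Icc_self hτ) v
      ⟨hτ.1.trans hv.1.le, hv.2.le⟩ hv.1.le

theorem IncrementsLE.eventually_norm_riemannSum_le (hU : IncrementsLE U k a b) :
    ∀ᶠ p in divisions a b, ‖p.riemannSum U‖ ≤ k b - k a := by
  simpa using hU.isApproxPrimitive_zero.eventually_norm_sub_riemannSum_le

theorem HasKurzweilIntegral.norm_le (hab : a ≤ b) (hI : HasKurzweilIntegral U a b I)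
    (hU : IncrementsLE U k a b) : ‖I‖ ≤ k b - k a :=
  have := divisions_neBot hab
  le_of_tendsto (hasKurzweilIntegral_iff_tendsto.1 hI).norm hU.eventually_norm_riemannSum_le

theorem HasKurzweilIntegral.norm_sub_le {m : ℝ} (hm : m ∈ Icc a b)
    (hI : HasKurzweilIntegral U a m I) (hJ : HasKurzweilIntegral U a b J)
    (hU : IncrementsLE U k m b) : ‖J - I‖ ≤ k b - k m := by
  rw [hasKurzweilIntegral_iff_tendsto] at hI hJ
  have := divisions_neBot hm.1
  have := divisions_neBot hm.2
  refine le_of_tendsto ((hJ.comp (tendsto_append hm)).sub (hI.comp tendsto_fst)).norm ?_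
  filter_upwards [eventually_riemannSum_append U,
    tendsto_snd.eventually hU.eventually_norm_riemannSum_le] with p hp hle
  simpa only [Function.comp_apply, hp, add_sub_cancel_left] using hle

end IncrementsLE

theorem exists_hasKurzweilIntegral_of_isApproxPrimitive [CompleteSpace X] (hab : a ≤ b)
    (h : ∀ ε > 0, ∃ (I : ℝ → X) (g : ℝ → ℝ), IsApproxPrimitive U I g a b ∧ g b - g a ≤ ε) :
    ∃ J, HasKurzweilIntegral U a b J := by
  have := divisions_neBot hab
  simp only [hasKurzweilIntegral_iff_tendsto]
  refine cauchy_map_iff_exists_tendsto.1 (Metric.cauchy_iff.2 ⟨inferInstance, fun ε hε => ?_⟩)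
  obtain ⟨I, g, hI, hg⟩ := h (ε / 3) (by positivity)
  refine ⟨Metric.closedBall (I b - I a) (ε / 3), ?_, fun x hx y hy => ?_⟩
  · exact hI.eventually_norm_sub_riemannSum_le.mono fun p hp =>
      mem_closedBall_iff_norm'.2 (hp.trans hg)
  · have := dist_triangle_right x y (I b - I a)
    linarith [Metric.mem_closedBall.1 hx, Metric.mem_closedBall.1 hy]

/-- The function that agrees with `f` up to `m` and continues with the increments of `g`. -/
noncomputable def joinAt {Y : Type*} [AddCommGroup Y] (m : ℝ) (f g : ℝ → Y) (t : ℝ) : Y :=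
  if t ≤ m then f t else f m + (g t - g m)

section JoinAt

variable {Y : Type*} [AddCommGroup Y] {m s t : ℝ} (f g : ℝ → Y)

theorem joinAt_sub_of_le (hs : s ≤ m) (ht : t ≤ m) :
    joinAt m f g t - joinAt m f g s = f t - f s := by
  rw [joinAt, joinAt, if_pos ht, if_pos hs]

theorem joinAt_of_ge (ht : m ≤ t) : joinAt m f g t = f m + (g t - g m) := by
  rcases ht.eq_or_lt with rfl | ht
  · simp [joinAt]
  · exact if_neg ht.not_ge

theorem joinAt_sub_of_ge (hs : m ≤ s) (ht : m ≤ t) :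
    joinAt m f g t - joinAt m f g s = g t - g s := by
  rw [joinAt_of_ge f g hs, joinAt_of_ge f g ht, add_sub_add_left_eq_sub, sub_sub_sub_cancel_right]

theorem joinAt_sub_of_mem_Icc (hm : m ∈ Icc s t) :
    joinAt m f g t - joinAt m f g s = (f m - f s) + (g t - g m) := by
  rw [joinAt_of_ge f g hm.2, joinAt, if_pos hm.1]
  abel

end JoinAt

namespace IsApproxPrimitive

theorem join {I₁ I₂ : ℝ → X} {g₁ g₂ : ℝ → ℝ} {m : ℝ} (h₁ : IsApproxPrimitive U I₁ g₁ a m)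
    (h₂ : IsApproxPrimitive U I₂ g₂ m b) :
    IsApproxPrimitive U (joinAt m I₁ I₂) (joinAt m g₁ g₂) a b where
  left τ hτ := by
    rcases le_or_gt τ m with hτm | hmτ
    · filter_upwards [h₁.left τ ⟨hτ.1, hτm⟩, self_mem_nhdsWithin] with u hu huτ
      have hum := (le_of_lt huτ).trans hτm
      rwa [joinAt_sub_of_le _ _ hum hτm, joinAt_sub_of_le _ _ hum hτm]
    · filter_upwards [h₂.left τ ⟨hmτ, hτ.2⟩, Ioo_mem_nhdsLT hmτ] with u hu hmu
      rwa [joinAt_sub_of_ge _ _ hmu.1.le hmτ.le, joinAt_sub_of_ge _ _ hmu.1.le hmτ.le]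
  right τ hτ := by
    rcases lt_or_ge τ m with hτm | hmτ
    · filter_upwards [h₁.right τ ⟨hτ.1, hτm⟩, Ioo_mem_nhdsGT hτm] with v hv hvm
      rwa [joinAt_sub_of_le _ _ hτm.le hvm.2.le, joinAt_sub_of_le _ _ hτm.le hvm.2.le]
    · filter_upwards [h₂.right τ ⟨hmτ, hτ.2⟩, self_mem_nhdsWithin] with v hv hτv
      have hmv := hmτ.trans (le_of_lt hτv)
      rwa [joinAt_sub_of_ge _ _ hmτ hmv, joinAt_sub_of_ge _ _ hmτ hmv]

theorem exists_of_forall_Ioo {c d m θ : ℝ} {k : ℝ → ℝ} {l l' : X} (hm : m ∈ Ioo c d)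
    (hk : MonotoneOn k (Icc c d)) (hθ : 0 < θ)
    (hc : Tendsto (fun t => U m t - U c t) (𝓝[>] c) (𝓝 l))
    (hd : Tendsto (fun t => U m t - U d t) (𝓝[<] d) (𝓝 l'))
    (hU : ∀ σ ∈ Ioo c d, ∀ u ∈ Ioo c d, ∀ v ∈ Ioo c d, u ≤ v →
      ‖(U m v - U m u) - (U σ v - U σ u)‖ ≤ k v - k u) :
    ∃ (I : ℝ → X) (g : ℝ → ℝ), IsApproxPrimitive U I g c d ∧
      g d - g c = k d - k c + 2 * θ := by
  have hcd : c < d := hm.1.trans hm.2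
  -- `I c` and `I d` are the values that make the jumps of `I` those of `U c` and `U d`.
  let I : ℝ → X := Function.update (Function.update (U m) c (l + U c c)) d (l' + U d d)
  let g : ℝ → ℝ := Function.update (Function.update k c (k c - θ)) d (k d + θ)
  have hI : ∀ t ∈ Ioo c d, I t = U m t := fun t ht => by simp [I, ht.1.ne', ht.2.ne]
  have hg : ∀ t ∈ Ioo c d, g t = k t := fun t ht => by simp [g, ht.1.ne', ht.2.ne]
  have hIc : I c = l + U c c := by simp [I, hcd.ne]
  have hgc : g c = k c - θ := by simp [g, hcd.ne]
  have hId : I d = l' + U d d := by simp [I]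
  have hgd : g d = k d + θ := by simp [g]
  refine ⟨I, g, ⟨fun τ hτ => ?_, fun τ hτ => ?_⟩, by rw [hgc, hgd]; ring⟩
  · rcases hτ.2.eq_or_lt with rfl | hτd
    · filter_upwards [Metric.tendsto_nhds.1 hd θ hθ, Ioo_mem_nhdsLT hcd] with u hu hcu
      have hku := hk (Ioo_subset_Icc_self hcu) (right_mem_Icc.2 hcd.le) hcu.2.le
      rw [hI u hcu, hg u hcu, hId, hgd]
      calc _ = dist (U m u - U τ u) l' := by rw [dist_eq_norm, ← norm_neg]; congr 1; abel
        _ ≤ _ := by linarith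
    · filter_upwards [Ioo_mem_nhdsLT hτ.1] with u hu
      have hu' : u ∈ Ioo c d := ⟨hu.1, hu.2.trans hτd⟩
      rw [hI u hu', hg u hu', hI τ ⟨hτ.1, hτd⟩, hg τ ⟨hτ.1, hτd⟩]
      exact hU τ ⟨hτ.1, hτd⟩ u hu' τ ⟨hτ.1, hτd⟩ hu.2.le
  · rcases hτ.1.eq_or_lt with rfl | hcτ
    · filter_upwards [Metric.tendsto_nhds.1 hc θ hθ, Ioo_mem_nhdsGT hcd] with v hv hcv
      have hkv := hk (left_mem_Icc.2 hcd.le) (Ioo_subset_Icc_self hcv) hcv.1.le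
      rw [hI v hcv, hg v hcv, hIc, hgc]
      calc _ = dist (U m v - U c v) l := by rw [dist_eq_norm]; congr 1; abel
        _ ≤ _ := by linarith
    · filter_upwards [Ioo_mem_nhdsGT hτ.2] with v hv
      have hv' : v ∈ Ioo c d := ⟨hcτ.trans hv.1, hv.2⟩
      rw [hI v hv', hg v hv', hI τ ⟨hcτ, hτ.2⟩, hg τ ⟨hcτ, hτ.2⟩]
      exact hU τ ⟨hcτ, hτ.2⟩ τ ⟨hcτ, hτ.2⟩ v hv' hv.1.le

end IsApproxPrimitive

end KurzweilIntegral

/-! ### Regulated functions and existence of the integral -/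

section Regulated

variable {X Y : Type*} [NormedAddCommGroup X] [NormedAddCommGroup Y] {a b : ℝ}

theorem isRegulated_of_monotoneOn {k : ℝ → ℝ} (hk : MonotoneOn k (Icc a b)) :
    IsRegulated k a b := by
  refine ⟨fun t ht => ?_, fun t ht => ?_⟩
  · have hsub : Ioo a t ⊆ Icc a b := fun s hs => ⟨hs.1.le, hs.2.le.trans ht.2⟩
    exact ⟨_, (hk.mono hsub).tendsto_nhdsWithin_Ioo_left (nonempty_Ioo.2 ht.1)
      (bddAbove_Icc.mono ((image_mono hsub).trans hk.image_Icc_subset))⟩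
  · have hsub : Ioo t b ⊆ Icc a b := fun s hs => ⟨ht.1.trans hs.1.le, hs.2.le⟩
    exact ⟨_, (hk.mono hsub).tendsto_nhdsWithin_Ioo_right (nonempty_Ioo.2 ht.2)
      (bddBelow_Icc.mono ((image_mono hsub).trans hk.image_Icc_subset))⟩

theorem IsRegulated.mono {f : ℝ → X} {c d : ℝ} (hf : IsRegulated f a b) (hac : a ≤ c)
    (hdb : d ≤ b) : IsRegulated f c d :=
  ⟨fun t ht => hf.1 t ⟨hac.trans_lt ht.1, ht.2.trans hdb⟩,
    fun t ht => hf.2 t ⟨hac.trans ht.1, ht.2.trans_le hdb⟩⟩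

theorem IsRegulated.prodMk {f : ℝ → X} {g : ℝ → Y} (hf : IsRegulated f a b)
    (hg : IsRegulated g a b) : IsRegulated (fun t => (f t, g t)) a b := by
  refine ⟨fun t ht => ?_, fun t ht => ?_⟩
  · obtain ⟨l, hl⟩ := hf.1 t ht
    obtain ⟨m, hm⟩ := hg.1 t ht
    exact ⟨(l, m), hl.prodMk_nhds hm⟩
  · obtain ⟨l, hl⟩ := hf.2 t ht
    obtain ⟨m, hm⟩ := hg.2 t ht
    exact ⟨(l, m), hl.prodMk_nhds hm⟩

theorem exists_tendsto_of_norm_sub_le_abs [CompleteSpace X] {l : Filter ℝ} [NeBot l] {S : Set ℝ}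
    (hS : S ∈ l) {f : ℝ → X} {k : ℝ → ℝ} (hk : ∃ c, Tendsto k l (𝓝 c))
    (hf : ∀ s ∈ S, ∀ t ∈ S, ‖f t - f s‖ ≤ |k t - k s|) : ∃ c, Tendsto f l (𝓝 c) := by
  refine cauchy_map_iff_exists_tendsto.1 (cauchy_map_iff'.2 ?_)
  rw [← cauchy_map_iff_exists_tendsto, cauchy_map_iff'] at hk
  rw [tendsto_uniformity_iff_dist_tendsto_zero] at hk ⊢
  refine squeeze_zero' (.of_forall fun _ => dist_nonneg) ?_ hk
  filter_upwards [prod_mem_prod hS hS] with p hp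
  simpa only [dist_eq_norm, Real.norm_eq_abs] using hf p.2 hp.2 p.1 hp.1

theorem IsRegulated.of_norm_sub_le [CompleteSpace X] {f : ℝ → X} {k : ℝ → ℝ}
    (hk : IsRegulated k a b)
    (hf : ∀ s ∈ Icc a b, ∀ t ∈ Icc a b, s ≤ t → ‖f t - f s‖ ≤ k t - k s) :
    IsRegulated f a b := by
  replace hf : ∀ s ∈ Icc a b, ∀ t ∈ Icc a b, ‖f t - f s‖ ≤ |k t - k s| := fun s hs t ht => by
    rcases le_total s t with hst | hts
    · exact (hf s hs t ht hst).trans (le_abs_self _)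
    · rw [norm_sub_rev, abs_sub_comm]
      exact (hf t ht s hs hts).trans (le_abs_self _)
  refine ⟨fun t ht => exists_tendsto_of_norm_sub_le_abs (Ioo_mem_nhdsLT ht.1) (hk.1 t ht) ?_,
    fun t ht => exists_tendsto_of_norm_sub_le_abs (Ioo_mem_nhdsGT ht.2) (hk.2 t ht) ?_⟩
  · have hsub : Ioo a t ⊆ Icc a b := fun s hs => ⟨hs.1.le, hs.2.le.trans ht.2⟩
    exact fun s hs t ht => hf s (hsub hs) t (hsub ht)
  · have hsub : Ioo t b ⊆ Icc a b := fun s hs => ⟨ht.1.trans hs.1.le, hs.2.le⟩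
    exact fun s hs t ht => hf s (hsub hs) t (hsub ht)

theorem IsRegulated.eventually_norm_sub_lt_left {y : ℝ → Y} (hy : IsRegulated y a b) {τ η : ℝ}
    (hτ : τ ∈ Ioc a b) (hη : 0 < η) :
    ∀ᶠ c in 𝓝[<] τ, ∀ σ ∈ Ioo c τ, ∀ σ' ∈ Ioo c τ, ‖y σ - y σ'‖ < η := by
  obtain ⟨l, hl⟩ := hy.1 τ hτ
  obtain ⟨c₀, hc₀, hsub⟩ := (mem_nhdsLT_iff_exists_Ioo_subset' hτ.1).1
    (Metric.tendsto_nhds.1 hl (η / 2) (half_pos hη))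
  filter_upwards [Ioo_mem_nhdsLT hc₀] with c hc σ hσ σ' hσ'
  have h₁ := hsub ⟨hc.1.trans hσ.1, hσ.2⟩
  have h₂ := hsub ⟨hc.1.trans hσ'.1, hσ'.2⟩
  exact (dist_eq_norm (y σ) (y σ')) ▸ (dist_triangle_right _ _ l).trans_lt
    ((add_lt_add h₁ h₂).trans_eq (add_halves η))

theorem IsRegulated.eventually_norm_sub_lt_right {y : ℝ → Y} (hy : IsRegulated y a b) {τ η : ℝ}
    (hτ : τ ∈ Ico a b) (hη : 0 < η) :
    ∀ᶠ d in 𝓝[>] τ, ∀ σ ∈ Ioo τ d, ∀ σ' ∈ Ioo τ d, ‖y σ - y σ'‖ < η := by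
  obtain ⟨l, hl⟩ := hy.2 τ hτ
  obtain ⟨d₀, hd₀, hsub⟩ := (mem_nhdsGT_iff_exists_Ioo_subset' hτ.2).1
    (Metric.tendsto_nhds.1 hl (η / 2) (half_pos hη))
  filter_upwards [Ioo_mem_nhdsGT hd₀] with d hd σ hσ σ' hσ'
  have h₁ := hsub ⟨hσ.1, hσ.2.trans hd.2⟩
  have h₂ := hsub ⟨hσ'.1, hσ'.2.trans hd.2⟩
  exact (dist_eq_norm (y σ) (y σ')) ▸ (dist_triangle_right _ _ l).trans_lt
    ((add_lt_add h₁ h₂).trans_eq (add_halves η))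

theorem IsRegulated.sub {f g : ℝ → X} (hf : IsRegulated f a b) (hg : IsRegulated g a b) :
    IsRegulated (fun t => f t - g t) a b := by
  refine ⟨fun t ht => ?_, fun t ht => ?_⟩
  · obtain ⟨l, hl⟩ := hf.1 t ht
    obtain ⟨m, hm⟩ := hg.1 t ht
    exact ⟨l - m, hl.sub hm⟩
  · obtain ⟨l, hl⟩ := hf.2 t ht
    obtain ⟨m, hm⟩ := hg.2 t ht
    exact ⟨l - m, hl.sub hm⟩

variable {U : ℝ → ℝ → X} {h : ℝ → ℝ}

theorem exists_isApproxPrimitive_of_oscillation {c d ε : ℝ} (hcd : c < d) (hε : 0 < ε)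
    (hh : MonotoneOn h (Icc c d)) (hU : ∀ τ ∈ Icc c d, IsRegulated (U τ) c d)
    (hosc : ∀ σ ∈ Ioo c d, ∀ σ' ∈ Ioo c d, ∀ u ∈ Icc c d, ∀ v ∈ Icc c d, u ≤ v →
      ‖(U σ v - U σ u) - (U σ' v - U σ' u)‖ ≤ ε * (h v - h u)) :
    ∃ (I : ℝ → X) (g : ℝ → ℝ), IsApproxPrimitive U I g c d ∧
      g d - g c = ε * ((h d + d) - (h c + c)) := by
  obtain ⟨m, hm⟩ := exists_between hcd
  have hmU := hU m (Ioo_subset_Icc_self hm)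
  obtain ⟨l, hl⟩ := (hmU.sub (hU c (left_mem_Icc.2 hcd.le))).2 c (left_mem_Ico.2 hcd)
  obtain ⟨l', hl'⟩ := (hmU.sub (hU d (right_mem_Icc.2 hcd.le))).1 d (right_mem_Ioc.2 hcd)
  obtain ⟨I, g, hI, hg⟩ := IsApproxPrimitive.exists_of_forall_Ioo (k := fun t => ε * h t) hm
    (fun s hs t ht hst => mul_le_mul_of_nonneg_left (hh hs ht hst) hε.le)
    (θ := ε * (d - c) / 2) (by have := mul_pos hε (sub_pos.2 hcd); linarith) hl hl'
    fun σ hσ u hu v hv huv => (hosc m hm σ hσ u (Ioo_subset_Icc_self hu) v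
      (Ioo_subset_Icc_self hv) huv).trans_eq (mul_sub _ _ _)
  exact ⟨I, g, hI, hg.trans (by ring)⟩

theorem exists_isApproxPrimitive {y : ℝ → Y} {ε : ℝ} (hab : a ≤ b) (hε : 0 < ε)
    (hh : MonotoneOn h (Icc a b)) (hy : IsRegulated y a b)
    (hU : ∀ τ ∈ Icc a b, IsRegulated (U τ) a b)
    (hUy : ∃ η > 0, ∀ σ ∈ Icc a b, ∀ σ' ∈ Icc a b, ‖y σ - y σ'‖ < η →
      ∀ u ∈ Icc a b, ∀ v ∈ Icc a b, u ≤ v →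
        ‖(U σ v - U σ u) - (U σ' v - U σ' u)‖ ≤ ε * (h v - h u)) :
    ∃ (I : ℝ → X) (g : ℝ → ℝ), IsApproxPrimitive U I g a b ∧
      g b - g a = ε * ((h b + b) - (h a + a)) := by
  obtain ⟨η, hη, hUη⟩ := hUy
  have hlocal : ∀ c ∈ Icc a b, ∀ d ∈ Icc a b, c < d →
      (∀ σ ∈ Ioo c d, ∀ σ' ∈ Ioo c d, ‖y σ - y σ'‖ < η) →
      ∃ (I : ℝ → X) (g : ℝ → ℝ), IsApproxPrimitive U I g c d ∧
        g d - g c = ε * ((h d + d) - (h c + c)) := fun c hc d hd hcd hosc => by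
    have hsub : Icc c d ⊆ Icc a b := Icc_subset_Icc hc.1 hd.2
    have hsub' : Ioo c d ⊆ Icc a b := Ioo_subset_Icc_self.trans hsub
    exact exists_isApproxPrimitive_of_oscillation hcd hε (hh.mono hsub)
      (fun τ hτ => (hU τ (hsub hτ)).mono hc.1 hd.2) fun σ hσ σ' hσ' u hu v hv =>
        hUη σ (hsub' hσ) σ' (hsub' hσ') (hosc σ hσ σ' hσ') u (hsub hu) v (hsub hv)
  refine interval_induction (P := fun c d => ∃ (I : ℝ → X) (g : ℝ → ℝ),
    IsApproxPrimitive U I g c d ∧ g d - g c = ε * ((h d + d) - (h c + c))) hab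
    ⟨0, 0, ⟨by simp, by simp⟩, by simp⟩ ?_ ?_ ?_
  · rintro m hm d hd ⟨I₁, g₁, hI₁, hg₁⟩ ⟨I₂, g₂, hI₂, hg₂⟩
    refine ⟨_, _, hI₁.join hI₂, ?_⟩
    rw [joinAt_sub_of_mem_Icc _ _ ⟨hm.1, hd.1⟩, hg₁, hg₂]
    ring
  · intro τ hτ
    filter_upwards [hy.eventually_norm_sub_lt_left hτ hη, Ioo_mem_nhdsLT hτ.1] with c hosc hc
    exact hlocal c ⟨hc.1.le, hc.2.le.trans hτ.2⟩ τ (Ioc_subset_Icc_self hτ) hc.2 hosc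
  · intro τ hτ
    filter_upwards [hy.eventually_norm_sub_lt_right hτ hη, Ioo_mem_nhdsGT hτ.2] with d hosc hd
    exact hlocal τ (Ico_subset_Icc_self hτ) d ⟨hτ.1.trans hd.1.le, hd.2.le⟩ hd.1 hosc

theorem exists_hasKurzweilIntegral [CompleteSpace X] {y : ℝ → Y} (hh : MonotoneOn h (Icc a b))
    (hy : IsRegulated y a b) (hU : ∀ τ ∈ Icc a b, IsRegulated (U τ) a b)
    (hUy : ∀ ε > 0, ∃ η > 0, ∀ σ ∈ Icc a b, ∀ σ' ∈ Icc a b, ‖y σ - y σ'‖ < η →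
      ∀ u ∈ Icc a b, ∀ v ∈ Icc a b, u ≤ v →
        ‖(U σ v - U σ u) - (U σ' v - U σ' u)‖ ≤ ε * (h v - h u)) {s : ℝ} (hs : s ∈ Icc a b) :
    ∃ J, HasKurzweilIntegral U a s J := by
  have hsub : Icc a s ⊆ Icc a b := Icc_subset_Icc_right hs.2
  refine exists_hasKurzweilIntegral_of_isApproxPrimitive hs.1 fun ε hε => ?_
  obtain ⟨κ, hκ, hκε⟩ := exists_pos_mul_lt hε ((h s + s) - (h a + a))
  obtain ⟨η, hη, hUη⟩ := hUy κ hκ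
  obtain ⟨I, g, hI, hg⟩ := exists_isApproxPrimitive hs.1 hκ (hh.mono hsub) (hy.mono le_rfl hs.2)
    (fun τ hτ => (hU τ (hsub hτ)).mono le_rfl hs.2)
    ⟨η, hη, fun σ hσ σ' hσ' hσσ' u hu v hv =>
      hUη σ (hsub hσ) σ' (hsub hσ') hσσ' u (hsub hu) v (hsub hv)⟩
  exact ⟨I, g, hI, by rw [hg, mul_comm]; exact hκε.le⟩

theorem IncrementsLE.isRegulated [CompleteSpace X] {k : ℝ → ℝ} (hU : IncrementsLE U k a b)
    (hk : MonotoneOn k (Icc a b)) {τ : ℝ} (hτ : τ ∈ Icc a b) : IsRegulated (U τ) a b :=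
  (isRegulated_of_monotoneOn hk).of_norm_sub_le fun u hu v hv => hU τ hτ u hu v hv

theorem IncrementsLE.isRegulated_primitive [CompleteSpace X] {k : ℝ → ℝ} {w : ℝ → X} {c : X}
    (hU : IncrementsLE U k a b) (hk : MonotoneOn k (Icc a b))
    (hw : ∀ s ∈ Icc a b, HasKurzweilIntegral U a s (w s - c)) : IsRegulated w a b :=
  (isRegulated_of_monotoneOn hk).of_norm_sub_le fun s hs t ht hst => by
    simpa only [sub_sub_sub_cancel_right] using
      (hw s hs).norm_sub_le ⟨hs.1, hst⟩ (hw t ht) (hU.mono hs.1 ht.2)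

end Regulated

/-! ### The classes `𝓕(Ω × [0, T], h, ω; X)` -/

section ClassF

variable {V X Y : Type*} [NormedAddCommGroup V] [NormedAddCommGroup X] [NormedAddCommGroup Y]
  {Ω : Set V} {T : ℝ} {h ω : ℝ → ℝ} {f : V → ℝ → X}

theorem IsModulus.tendsto_zero (hω : IsModulus ω) : Tendsto ω (𝓝[≥] 0) (𝓝 0) := by
  simpa only [ContinuousWithinAt, hω.2.2] using hω.2.1 0 self_mem_Ici

theorem IsModulus.exists_le (hω : IsModulus ω) {ε : ℝ} (hε : 0 < ε) :
    ∃ η > 0, ∀ x : V, ‖x‖ < η → ω ‖x‖ ≤ ε := by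
  obtain ⟨η, hη, hsub⟩ := mem_nhdsGE_iff_exists_Ico_subset.1
    (hω.tendsto_zero.eventually_le_const hε)
  exact ⟨η, hη, fun x hx => hsub ⟨norm_nonneg x, hx⟩⟩

namespace ClassF

theorem norm_sub_le (hf : ClassF Ω T h ω f) (hh : MonotoneOn h (Icc 0 T)) {x : V} (hx : x ∈ Ω)
    {u v : ℝ} (hu : u ∈ Icc 0 T) (hv : v ∈ Icc 0 T) (huv : u ≤ v) :
    ‖f x v - f x u‖ ≤ h v - h u :=
  (hf.1 x hx u hu v hv).trans_eq (abs_of_nonneg (sub_nonneg.2 (hh hu hv huv)))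

theorem norm_sub_sub_le (hf : ClassF Ω T h ω f) (hh : MonotoneOn h (Icc 0 T)) {x y : V}
    (hx : x ∈ Ω) (hy : y ∈ Ω) {u v : ℝ} (hu : u ∈ Icc 0 T) (hv : v ∈ Icc 0 T) (huv : u ≤ v) :
    ‖(f x v - f x u) - (f y v - f y u)‖ ≤ ω ‖x - y‖ * (h v - h u) := by
  have := hf.2 x hx y hy u hu v hv
  rwa [abs_of_nonneg (sub_nonneg.2 (hh hu hv huv)), sub_add] at this

theorem incrementsLE (hf : ClassF Ω T h ω f) (hh : MonotoneOn h (Icc 0 T)) {y : ℝ → V}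
    (hy : ∀ t ∈ Icc 0 T, y t ∈ Ω) : IncrementsLE (fun τ t => f (y τ) t) h 0 T :=
  fun τ hτ _ hu _ hv huv => hf.norm_sub_le hh (hy τ hτ) hu hv huv

theorem exists_hasKurzweilIntegral [CompleteSpace X] (hf : ClassF Ω T h ω f)
    (hh : MonotoneOn h (Icc 0 T)) (hω : IsModulus ω) {y : ℝ → V} (hy : IsRegulated y 0 T)
    (hyΩ : ∀ t ∈ Icc 0 T, y t ∈ Ω) {s : ℝ} (hs : s ∈ Icc 0 T) :
    ∃ J, HasKurzweilIntegral (fun τ t => f (y τ) t) 0 s J := by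
  refine GenODE.exists_hasKurzweilIntegral hh hy
    (fun τ hτ => (hf.incrementsLE hh hyΩ).isRegulated hh hτ) (fun ε hε => ?_) hs
  obtain ⟨η, hη, hωη⟩ := hω.exists_le (V := V) hε
  refine ⟨η, hη, fun σ hσ σ' hσ' hσσ' u hu v hv huv => ?_⟩
  refine (hf.norm_sub_sub_le hh (hyΩ σ hσ) (hyΩ σ' hσ') hu hv huv).trans ?_
  exact mul_le_mul_of_nonneg_right (hωη _ hσσ') (sub_nonneg.2 (hh hu hv huv))

section ClmApply

variable [NormedSpace ℝ X] [NormedSpace ℝ Y] {D : V → ℝ → X →L[ℝ] Y} {x : ℝ → V} {z : ℝ → X}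
  {C : ℝ}

theorem incrementsLE_clm_apply (hD : ClassF Ω T h ω D) (hh : MonotoneOn h (Icc 0 T))
    (hx : ∀ t ∈ Icc 0 T, x t ∈ Ω) (hz : ∀ t ∈ Icc 0 T, ‖z t‖ ≤ C) :
    IncrementsLE (fun τ t => D (x τ) t (z τ)) (fun t => h t * C) 0 T := fun τ hτ u hu v hv huv =>
  calc ‖D (x τ) v (z τ) - D (x τ) u (z τ)‖ = ‖(D (x τ) v - D (x τ) u) (z τ)‖ := rfl
    _ ≤ (h v - h u) * C := ContinuousLinearMap.le_of_opNorm_le_of_le _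
        (hD.norm_sub_le hh (hx τ hτ) hu hv huv) (hz τ hτ)
    _ = h v * C - h u * C := sub_mul _ _ _

theorem norm_clm_apply_sub_sub_le (hD : ClassF Ω T h ω D) (hh : MonotoneOn h (Icc 0 T))
    {x x' : V} (hx : x ∈ Ω) (hx' : x' ∈ Ω) {z z' : X} (hz : ‖z‖ ≤ C) {u v : ℝ}
    (hu : u ∈ Icc 0 T) (hv : v ∈ Icc 0 T) (huv : u ≤ v) :
    ‖(D x v z - D x u z) - (D x' v z' - D x' u z')‖ ≤
      (ω ‖x - x'‖ * C + ‖z - z'‖) * (h v - h u) :=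
  calc _ = ‖((D x v - D x u) - (D x' v - D x' u)) z + (D x' v - D x' u) (z - z')‖ := by
        simp only [_root_.sub_apply, map_sub]
        congr 1
        abel
    _ ≤ ω ‖x - x'‖ * (h v - h u) * C + (h v - h u) * ‖z - z'‖ := norm_add_le_of_le
        (ContinuousLinearMap.le_of_opNorm_le_of_le _ (hD.norm_sub_sub_le hh hx hx' hu hv huv) hz)
        (ContinuousLinearMap.le_of_opNorm_le _ (hD.norm_sub_le hh hx' hu hv huv) _)
    _ = (ω ‖x - x'‖ * C + ‖z - z'‖) * (h v - h u) := by ring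

theorem exists_hasKurzweilIntegral_clm_apply [CompleteSpace Y] (hD : ClassF Ω T h ω D)
    (hh : MonotoneOn h (Icc 0 T)) (hω : IsModulus ω) (hx : IsRegulated x 0 T)
    (hxΩ : ∀ t ∈ Icc 0 T, x t ∈ Ω) (hz : IsRegulated z 0 T) {s : ℝ} (hs : s ∈ Icc 0 T) :
    ∃ J, HasKurzweilIntegral (fun τ t => D (x τ) t (z τ)) 0 s J := by
  obtain ⟨C, hC⟩ := hz.bounded
  have hC₀ : 0 ≤ C := (norm_nonneg _).trans (hC s hs)
  have hhC : MonotoneOn (fun t => h t * C) (Icc 0 T) :=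
    (monotone_mul_right_of_nonneg hC₀).comp_monotoneOn hh
  refine GenODE.exists_hasKurzweilIntegral hh (hx.prodMk hz)
    (fun τ hτ => (hD.incrementsLE_clm_apply hh hxΩ hC).isRegulated hhC hτ) (fun ε hε => ?_) hs
  obtain ⟨κ, hκ, hκε⟩ := exists_pos_mul_lt (half_pos hε) C
  obtain ⟨η, hη, hωη⟩ := hω.exists_le (V := V) hκ
  refine ⟨min η (ε / 2), lt_min hη (half_pos hε), fun σ hσ σ' hσ' hσσ' u hu v hv huv => ?_⟩
  obtain ⟨hη', hε'⟩ := lt_min_iff.1 hσσ'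
  refine (hD.norm_clm_apply_sub_sub_le hh (hxΩ σ hσ) (hxΩ σ' hσ') (hC σ hσ) hu hv huv).trans
    (mul_le_mul_of_nonneg_right ?_ (sub_nonneg.2 (hh hu hv huv)))
  calc ω ‖x σ - x σ'‖ * C + ‖z σ - z σ'‖ ≤ κ * C + ε / 2 :=
        add_le_add (mul_le_mul_of_nonneg_right (hωη _ ((norm_fst_le _).trans_lt hη')) hC₀)
          ((norm_snd_le _).trans hε'.le)
    _ ≤ ε := by linarith

end ClmApply

theorem norm_sub_sub_fderiv_le [NormedSpace ℝ V] [NormedSpace ℝ X] {D : V → ℝ → V →L[ℝ] X}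
    (hD : ClassF Ω T h ω D) (hh : MonotoneOn h (Icc 0 T)) (hω : MonotoneOn ω (Ici 0))
    (hfD : ∀ x ∈ Ω, ∀ t ∈ Icc 0 T, HasFDerivAt (fun y => f y t) (D x t) x) {x y : V}
    (hxy : segment ℝ x y ⊆ Ω) {u v : ℝ} (hu : u ∈ Icc 0 T) (hv : v ∈ Icc 0 T) (huv : u ≤ v) :
    ‖(f y v - f y u) - (f x v - f x u) - (D x v - D x u) (y - x)‖ ≤
      ω ‖y - x‖ * (h v - h u) * ‖y - x‖ := by
  refine (convex_segment x y).norm_image_sub_le_of_norm_hasFDerivWithin_le'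
    (f := fun z => f z v - f z u) (f' := fun z => D z v - D z u)
    (fun z hz => ((hfD z (hxy hz) v hv).sub (hfD z (hxy hz) u hu)).hasFDerivWithinAt)
    (fun z hz => ?_) (left_mem_segment ℝ x y) (right_mem_segment ℝ x y)
  have hzy : ‖z - x‖ ≤ ‖y - x‖ := norm_sub_le_of_mem_segment hz
  exact (hD.norm_sub_sub_le hh (hxy hz) (hxy (left_mem_segment ℝ x y)) hu hv huv).trans
    (mul_le_mul_of_nonneg_right (hω (norm_nonneg _) (norm_nonneg _) hzy)
      (sub_nonneg.2 (hh hu hv huv)))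

theorem map {C : ℝ} (hC : 0 ≤ C) (L : X →+ Y) (hL : ∀ v, ‖L v‖ ≤ C * ‖v‖)
    (hf : ClassF Ω T h ω f) : ClassF Ω T (fun t => C * h t) ω fun x t => L (f x t) := by
  refine ⟨fun x hx s hs t ht => ?_, fun x hx y hy s hs t ht => ?_⟩
  · rw [← map_sub, ← mul_sub, abs_mul, abs_of_nonneg hC]
    exact (hL _).trans (mul_le_mul_of_nonneg_left (hf.1 x hx s hs t ht) hC)
  · rw [← map_sub, ← map_sub, ← map_add, ← mul_sub, abs_mul, abs_of_nonneg hC, mul_left_comm]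
    exact (hL _).trans (mul_le_mul_of_nonneg_left (hf.2 x hx y hy s hs t ht) hC)

end ClassF

theorem UniformInParameter.map {Λ : Set ℝ} {f : ℝ → V → ℝ → X} {C : ℝ} (hC : 0 ≤ C)
    (L : X →+ Y) (hL : ∀ v, ‖L v‖ ≤ C * ‖v‖) (hf : UniformInParameter Λ Ω T f) :
    UniformInParameter Λ Ω T fun lam x t => L (f lam x t) := by
  obtain ⟨γ, hγ, hf⟩ := hf
  refine ⟨fun t => C * γ t, (monotone_mul_left_of_nonneg hC).comp_monotoneOn hγ, fun ε hε => ?_⟩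
  obtain ⟨δ, hδ, hf⟩ := hf ε hε
  refine ⟨δ, hδ, fun x hx t ht s hs l₁ hl₁ l₂ hl₂ hl => ?_⟩
  rw [← map_sub, ← map_sub, ← map_add, ← mul_sub, abs_mul, abs_of_nonneg hC, mul_left_comm]
  exact (hL _).trans (mul_le_mul_of_nonneg_left (hf x hx t ht s hs l₁ hl₁ l₂ hl₂ hl) hC)

end ClassF

section Jacobian

variable {n : ℕ}

theorem exists_norm_map_le {V W : Type*} [NormedAddCommGroup V] [NormedSpace ℝ V]
    [FiniteDimensional ℝ V] [NormedAddCommGroup W] [NormedSpace ℝ W] (L : V →ₗ[ℝ] W) :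
    ∃ C, 0 ≤ C ∧ ∀ v, ‖L v‖ ≤ C * ‖v‖ :=
  ⟨‖L.toContinuousLinearMap‖, norm_nonneg _, L.toContinuousLinearMap.le_opNorm⟩

/-- The operator on `ℝⁿ`, with the norm `∑ |xᵢ|`, defined by a matrix. -/
noncomputable def matrixCLM (n : ℕ) : Matrix (Fin n) (Fin n) ℝ →ₗ[ℝ] E n →L[ℝ] E n :=
  LinearMap.toContinuousLinearMap.toLinearMap ∘ₗ
    (LinearMap.toMatrix (PiLp.basisFun 1 ℝ (Fin n)) (PiLp.basisFun 1 ℝ (Fin n))).symm.toLinearMap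

theorem matrixCLM_jacobian (F : ℝ → E n → ℝ → E n) (lam : ℝ) (x : E n) (t : ℝ) :
    matrixCLM n (jacobian F lam x t) = fderiv ℝ (fun y => F lam y t) x := by
  ext v : 1
  simp [matrixCLM, jacobian]

attribute [local instance] Matrix.linftyOpNormedSpace in
theorem exists_norm_matrixCLM_le (n : ℕ) :
    ∃ C, 0 ≤ C ∧ ∀ M : Matrix (Fin n) (Fin n) ℝ, ‖matrixCLM n M‖ ≤ C * ‖M‖ :=
  exists_norm_map_le (matrixCLM n)

end Jacobian

/-! ### Integral operators on `G[0, T]` -/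

section

variable {n : ℕ} {T : ℝ}

theorem ev_of_mem (x : G n T) {t : ℝ} (ht : t ∈ Icc 0 T) : ev x t = (x : Bdd n T) ⟨t, ht⟩ := by
  simp only [ev, ext0, dif_pos ht]

theorem ev_of_notMem (x : G n T) {t : ℝ} (ht : t ∉ Icc 0 T) : ev x t = 0 := by
  simp only [ev, ext0, dif_neg ht]

theorem ev_add (x y : G n T) (t : ℝ) : ev (x + y) t = ev x t + ev y t := by
  by_cases ht : t ∈ Icc 0 T
  · simp [ev_of_mem _ ht]
  · simp [ev_of_notMem _ ht]

theorem ev_sub (x y : G n T) (t : ℝ) : ev (x - y) t = ev x t - ev y t := by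
  by_cases ht : t ∈ Icc 0 T
  · simp [ev_of_mem _ ht]
  · simp [ev_of_notMem _ ht]

theorem ev_smul (c : ℝ) (x : G n T) (t : ℝ) : ev (c • x) t = c • ev x t := by
  by_cases ht : t ∈ Icc 0 T
  · simp [ev_of_mem _ ht]
  · simp [ev_of_notMem _ ht]

theorem ev_mkG (f : ℝ → E n) (hf : IsRegulated f 0 T) {t : ℝ} (ht : t ∈ Icc 0 T) :
    ev (mkG f hf) t = f t := by
  rw [ev_of_mem _ ht]
  rfl

theorem ev_ext {x y : G n T} (h : ∀ t ∈ Icc 0 T, ev x t = ev y t) : x = y := by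
  refine Subtype.ext (lp.ext (funext fun t => ?_))
  rw [← ev_of_mem x t.2, ← ev_of_mem y t.2, h t t.2]

theorem isRegulated_ev (x : G n T) : IsRegulated (ev x) 0 T := x.2

theorem norm_ev_le (x : G n T) (t : ℝ) : ‖ev x t‖ ≤ ‖x‖ := by
  by_cases ht : t ∈ Icc 0 T
  · rw [ev_of_mem _ ht]
    exact lp.norm_apply_le_norm ENNReal.top_ne_zero (x : Bdd n T) ⟨t, ht⟩
  · simp [ev_of_notMem _ ht]

theorem norm_le_of_ev {x : G n T} {C : ℝ} (hC : 0 ≤ C) (h : ∀ t ∈ Icc 0 T, ‖ev x t‖ ≤ C) :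
    ‖x‖ ≤ C := by
  refine lp.norm_le_of_forall_le (f := (x : Bdd n T)) hC fun t => ?_
  rw [← ev_of_mem x t.2]
  exact h t t.2

theorem segment_ev_subset {x₀ x : G n T} {ρ : ℝ} {Ω : Set (E n)} {t : ℝ}
    (hΩ : ∀ x ∈ Metric.closedBall x₀ ρ, ev x t ∈ Ω) (hx : x ∈ Metric.closedBall x₀ ρ) :
    segment ℝ (ev x₀ t) (ev x t) ⊆ Ω := by
  rw [segment_eq_image_lineMap]
  rintro _ ⟨θ, hθ, rfl⟩
  have hx₀ : x₀ ∈ Metric.closedBall x₀ ρ :=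
    Metric.mem_closedBall_self (dist_nonneg.trans (Metric.mem_closedBall.1 hx))
  have := hΩ _ ((convex_closedBall x₀ ρ).lineMap_mem hx₀ hx hθ)
  rwa [AffineMap.lineMap_apply_module', ev_add, ev_smul, ev_sub,
    ← AffineMap.lineMap_apply_module'] at this

/-- `w(s) = c + ∫_0^s DU(τ, t)` for all `s ∈ [0, T]`. -/
def IsKurzweilPrimitive (U : ℝ → ℝ → E n) (c : E n) (w : G n T) : Prop :=
  ∀ s ∈ Icc 0 T, HasKurzweilIntegral U 0 s (ev w s - c)

theorem exists_isKurzweilPrimitive {U : ℝ → ℝ → E n} {k : ℝ → ℝ} (hk : MonotoneOn k (Icc 0 T))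
    (hU : IncrementsLE U k 0 T) (hJ : ∀ s ∈ Icc 0 T, ∃ J, HasKurzweilIntegral U 0 s J)
    (c : E n) : ∃ w : G n T, IsKurzweilPrimitive U c w := by
  choose! J hJ using hJ
  have hw : ∀ s ∈ Icc 0 T, HasKurzweilIntegral U 0 s (c + J s - c) := fun s hs =>
    (add_sub_cancel_left c (J s)).symm ▸ hJ s hs
  exact ⟨mkG _ (hU.isRegulated_primitive hk hw), fun s hs => by rw [ev_mkG _ _ hs]; exact hw s hs⟩

namespace IsKurzweilPrimitive

variable {U V : ℝ → ℝ → E n} {c d : E n} {v w : G n T} {k : ℝ → ℝ}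

theorem unique (hv : IsKurzweilPrimitive U c v) (hw : IsKurzweilPrimitive U c w) : v = w :=
  ev_ext fun s hs => sub_left_injective ((hv s hs).unique hs.1 (hw s hs))

theorem add (hv : IsKurzweilPrimitive U c v) (hw : IsKurzweilPrimitive V d w) :
    IsKurzweilPrimitive (fun τ t => U τ t + V τ t) (c + d) (v + w) := fun s hs => by
  simpa only [ev_add, add_sub_add_comm] using (hv s hs).add (hw s hs)

theorem sub (hv : IsKurzweilPrimitive U c v) (hw : IsKurzweilPrimitive V d w) :
    IsKurzweilPrimitive (fun τ t => U τ t - V τ t) (c - d) (v - w) := fun s hs => by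
  simpa only [ev_sub, sub_sub_sub_comm] using (hv s hs).sub (hw s hs)

theorem const_smul (r : ℝ) (hv : IsKurzweilPrimitive U c v) :
    IsKurzweilPrimitive (fun τ t => r • U τ t) (r • c) (r • v) := fun s hs => by
  simpa only [ev_smul, smul_sub] using (hv s hs).const_smul r

theorem norm_le (hT : 0 ≤ T) (hk : MonotoneOn k (Icc 0 T)) (hU : IncrementsLE U k 0 T)
    (hw : IsKurzweilPrimitive U c w) : ‖w‖ ≤ ‖c‖ + (k T - k 0) := by
  have h₀ : (0 : ℝ) ∈ Icc 0 T := left_mem_Icc.2 hT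
  have h_T : T ∈ Icc 0 T := right_mem_Icc.2 hT
  refine norm_le_of_ev (add_nonneg (norm_nonneg c) (sub_nonneg.2 (hk h₀ h_T hT))) fun s hs => ?_
  calc ‖ev w s‖ ≤ ‖c‖ + ‖ev w s - c‖ := norm_le_norm_add_norm_sub' _ _
    _ ≤ ‖c‖ + (k s - k 0) :=
        add_le_add_right ((hw s hs).norm_le hs.1 (hU.mono le_rfl hs.2)) _
    _ ≤ ‖c‖ + (k T - k 0) := by linarith [hk hs h_T hs.2]

theorem Phi_eq {F : ℝ → E n → ℝ → E n} {lam : ℝ} {x : G n T}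
    (hw : IsKurzweilPrimitive (fun τ t => F lam (ev x τ) t) (ev x T) w) : Phi F lam x = w := by
  have hPhi : ∀ s ∈ Icc 0 T, ev w s = PhiFun F lam x s := fun s hs => by
    rw [PhiFun, (hw s hs).kurzweilIntegral_eq hs.1, add_sub_cancel]
  have hreg : IsRegulated (PhiFun F lam x) 0 T := (isRegulated_ev w).congr hPhi
  rw [Phi, dif_pos hreg]
  exact ev_ext fun s hs => by rw [ev_mkG _ _ hs, hPhi s hs]

end IsKurzweilPrimitive

theorem IsPeriodicSolution.eq_Phi {F : ℝ → E n → ℝ → E n} {Ω : Set (E n)} {x : G n T} {lam : ℝ}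
    (hx : IsPeriodicSolution F Ω x lam) : x = Phi F lam x :=
  (IsKurzweilPrimitive.Phi_eq fun s hs => hx.2 ▸ (hx.1 s hs).2).symm

theorem ClassF.isKurzweilPrimitive_Phi {F : ℝ → E n → ℝ → E n} {Ω : Set (E n)} {h ω : ℝ → ℝ}
    {lam : ℝ} {x : G n T} (hF : ClassF Ω T h ω (F lam)) (hh : MonotoneOn h (Icc 0 T))
    (hω : IsModulus ω) (hx : ∀ t ∈ Icc 0 T, ev x t ∈ Ω) :
    IsKurzweilPrimitive (fun τ t => F lam (ev x τ) t) (ev x T) (Phi F lam x) := by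
  obtain ⟨w, hw⟩ := exists_isKurzweilPrimitive hh (hF.incrementsLE hh hx)
    (fun s hs => hF.exists_hasKurzweilIntegral hh hω (isRegulated_ev x) hx hs) (ev x T)
  exact hw.Phi_eq ▸ hw

/-- `(A z)(s) = z(T) + ∫_0^s D[D(x(τ), t) z(τ)]`: the formal derivative at `x` of the operator `Φ`
defined by a right-hand side whose derivative in `x` is `D`. -/
def IsLinearization (D : E n → ℝ → E n →L[ℝ] E n) (x : G n T) (A : G n T →L[ℝ] G n T) : Prop :=
  ∀ z, IsKurzweilPrimitive (fun τ t => D (ev x τ) t (ev z τ)) (ev z T) (A z)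

section Linearization

variable {D D₁ D₂ : E n → ℝ → E n →L[ℝ] E n} {Ω : Set (E n)} {h ω k : ℝ → ℝ} {x₀ x : G n T}
  {A A₁ A₂ : G n T →L[ℝ] G n T}

theorem ClassF.exists_isLinearization (hT : 0 ≤ T) (hD : ClassF Ω T h ω D)
    (hh : MonotoneOn h (Icc 0 T)) (hω : IsModulus ω) (hx : ∀ t ∈ Icc 0 T, ev x t ∈ Ω) :
    ∃ A : G n T →L[ℝ] G n T, IsLinearization D x A := by
  have hincr (z : G n T) :
      IncrementsLE (fun τ t => D (ev x τ) t (ev z τ)) (fun t => h t * ‖z‖) 0 T :=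
    hD.incrementsLE_clm_apply hh hx fun t _ => norm_ev_le z t
  have hmono (z : G n T) : MonotoneOn (fun t => h t * ‖z‖) (Icc 0 T) :=
    (monotone_mul_right_of_nonneg (norm_nonneg z)).comp_monotoneOn hh
  choose A hA using fun z : G n T => exists_isKurzweilPrimitive (hmono z) (hincr z)
    (fun s hs => hD.exists_hasKurzweilIntegral_clm_apply hh hω (isRegulated_ev x) hx
      (isRegulated_ev z) hs) (ev z T)
  have hadd : ∀ z z', A (z + z') = A z + A z' := fun z z' => (hA (z + z')).unique <| by
    simpa only [ev_add, map_add] using (hA z).add (hA z')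
  have hsmul : ∀ (r : ℝ) z, A (r • z) = r • A z := fun r z => (hA (r • z)).unique <| by
    simpa only [ev_smul, map_smul] using (hA z).const_smul r
  refine ⟨LinearMap.mkContinuous ⟨⟨A, hadd⟩, hsmul⟩ (1 + (h T - h 0)) fun z => ?_, hA⟩
  calc ‖A z‖ ≤ ‖ev z T‖ + (h T * ‖z‖ - h 0 * ‖z‖) := (hA z).norm_le hT (hmono z) (hincr z)
    _ ≤ ‖z‖ + (h T * ‖z‖ - h 0 * ‖z‖) := add_le_add_left (norm_ev_le z T) _
    _ = (1 + (h T - h 0)) * ‖z‖ := by ring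

theorem IsLinearization.norm_sub_le (hT : 0 ≤ T) (hk : MonotoneOn k (Icc 0 T))
    (h₁ : IsLinearization D₁ x A₁) (h₂ : IsLinearization D₂ x A₂)
    (hD : IncrementsLE (fun τ t => D₁ (ev x τ) t - D₂ (ev x τ) t) k 0 T) :
    ‖A₁ - A₂‖ ≤ k T - k 0 := by
  have hkT : 0 ≤ k T - k 0 := sub_nonneg.2 (hk (left_mem_Icc.2 hT) (right_mem_Icc.2 hT) hT)
  refine ContinuousLinearMap.opNorm_le_bound _ hkT fun z => ?_
  have hz := (h₁ z).sub (h₂ z)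
  rw [sub_self] at hz
  refine (hz.norm_le (k := fun t => k t * ‖z‖) hT
    ((monotone_mul_right_of_nonneg (norm_nonneg z)).comp_monotoneOn hk)
    fun τ hτ u hu v hv huv => ?_).trans_eq (by rw [norm_zero, zero_add, sub_mul])
  rw [← sub_mul]
  exact ContinuousLinearMap.le_of_opNorm_le_of_le _ (hD τ hτ u hu v hv huv) (norm_ev_le z τ)

theorem IsLinearization.norm_Phi_sub_sub_le {F : ℝ → E n → ℝ → E n} {h' ω' : ℝ → ℝ} {lam ρ : ℝ}
    (hA : IsLinearization D x₀ A) (hT : 0 ≤ T) (hF : ClassF Ω T h ω (F lam))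
    (hh : MonotoneOn h (Icc 0 T)) (hω : IsModulus ω) (hD : ClassF Ω T h' ω' D)
    (hh' : MonotoneOn h' (Icc 0 T)) (hω' : IsModulus ω')
    (hFD : ∀ x ∈ Ω, ∀ t ∈ Icc 0 T, HasFDerivAt (fun y => F lam y t) (D x t) x)
    (hΩ : ∀ t ∈ Icc 0 T, ∀ x ∈ Metric.closedBall x₀ ρ, ev x t ∈ Ω)
    (hx : x ∈ Metric.closedBall x₀ ρ) :
    ‖Phi F lam x - Phi F lam x₀ - A (x - x₀)‖ ≤
      ω' ‖x - x₀‖ * (h' T - h' 0) * ‖x - x₀‖ := by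
  have hx₀ : x₀ ∈ Metric.closedBall x₀ ρ :=
    Metric.mem_closedBall_self (dist_nonneg.trans (Metric.mem_closedBall.1 hx))
  have hrem := ((hF.isKurzweilPrimitive_Phi hh hω fun t ht => hΩ t ht x hx).sub
    (hF.isKurzweilPrimitive_Phi hh hω fun t ht => hΩ t ht x₀ hx₀)).sub (hA (x - x₀))
  rw [ev_sub, sub_self] at hrem
  have hω₀ : 0 ≤ ω' ‖x - x₀‖ := hω'.2.2.symm.trans_le
    (hω'.1.monotoneOn self_mem_Ici (norm_nonneg _) (norm_nonneg _))
  refine (hrem.norm_le (k := fun t => ω' ‖x - x₀‖ * h' t * ‖x - x₀‖) hT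
    ((monotone_mul_right_of_nonneg (norm_nonneg _)).comp_monotoneOn
      ((monotone_mul_left_of_nonneg hω₀).comp_monotoneOn hh'))
    fun τ hτ u hu v hv huv => ?_).trans_eq (by rw [norm_zero, zero_add]; ring)
  have hxτ : ‖ev x τ - ev x₀ τ‖ ≤ ‖x - x₀‖ := ev_sub x x₀ τ ▸ norm_ev_le (x - x₀) τ
  have hincr : 0 ≤ h' v - h' u := sub_nonneg.2 (hh' hu hv huv)
  calc _ = ‖(F lam (ev x τ) v - F lam (ev x τ) u) - (F lam (ev x₀ τ) v - F lam (ev x₀ τ) u) -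
          (D (ev x₀ τ) v - D (ev x₀ τ) u) (ev x τ - ev x₀ τ)‖ := by
        rw [ev_sub, _root_.sub_apply]
        congr 1
        abel
    _ ≤ ω' ‖ev x τ - ev x₀ τ‖ * (h' v - h' u) * ‖ev x τ - ev x₀ τ‖ :=
        hD.norm_sub_sub_fderiv_le hh' hω'.1.monotoneOn hFD (segment_ev_subset (hΩ τ hτ) hx)
          hu hv huv
    _ ≤ ω' ‖x - x₀‖ * (h' v - h' u) * ‖x - x₀‖ := by
        gcongr
        exact hω'.1.monotoneOn (norm_nonneg _) (norm_nonneg _) hxτ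
    _ = _ := by ring

theorem UniformInParameter.tendsto_norm_linearization_sub {Λ : Set ℝ}
    {D : ℝ → E n → ℝ → E n →L[ℝ] E n} {A : ℝ → G n T →L[ℝ] G n T} {lam₀ : ℝ} (hT : 0 ≤ T)
    (hD : UniformInParameter Λ Ω T D) (hx : ∀ t ∈ Icc 0 T, ev x t ∈ Ω)
    (hA : ∀ lam ∈ Λ, IsLinearization (D lam) x (A lam)) (hlam₀ : lam₀ ∈ Λ) :
    Tendsto (fun lam => ‖A lam - A lam₀‖) (𝓝[Λ] lam₀) (𝓝 0) := by
  obtain ⟨γ, hγ, hD⟩ := hD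
  refine NormedAddGroup.tendsto_nhds_zero.2 fun ε hε => ?_
  obtain ⟨κ, hκ, hκε⟩ := exists_pos_mul_lt hε (γ T - γ 0)
  obtain ⟨δ, hδ, hD⟩ := hD κ hκ
  filter_upwards [self_mem_nhdsWithin, mem_nhdsWithin_of_mem_nhds (Metric.ball_mem_nhds lam₀ hδ)]
    with lam hlam hdist
  have hincr : IncrementsLE (fun τ t => D lam (ev x τ) t - D lam₀ (ev x τ) t)
      (fun t => κ * γ t) 0 T := fun τ hτ u hu v hv huv => by
    have := hD (ev x τ) (hx τ hτ) v hv u hu lam hlam lam₀ hlam₀ hdist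
    rwa [abs_of_nonneg (sub_nonneg.2 (hγ hu hv huv)), mul_sub, sub_add] at this
  calc ‖‖A lam - A lam₀‖‖ = ‖A lam - A lam₀‖ := Real.norm_of_nonneg (A lam - A lam₀).opNorm_nonneg
    _ ≤ κ * γ T - κ * γ 0 := (hA lam hlam).norm_sub_le hT
        ((monotone_mul_left_of_nonneg hκ.le).comp_monotoneOn hγ) (hA lam₀ hlam₀) hincr
    _ < ε := by linarith

end Linearization

end

/-! ### Isolated solutions -/

theorem eventuallyEq_zero_of_isLittleO {α X : Type*} [NormedAddCommGroup X] [NormedSpace ℝ X]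
    {l : Filter α} {f : α → X} {A : X →L[ℝ] X}
    (hA : (ContinuousLinearMap.id ℝ X - A).IsInvertible)
    (hf : (fun p => f p - A (f p)) =o[l] f) : f =ᶠ[l] 0 := by
  obtain ⟨e, he⟩ := hA
  have hef : (fun p => f p - A (f p)) = fun p => e (f p) := funext fun p => by
    rw [← ContinuousLinearEquiv.coe_coe, he]
    rfl
  rw [hef] at hf
  have hff : f =o[l] f := (e.isBigO_comp_rev f l).trans_isLittleO hf
  by_contra hne
  exact Asymptotics.isLittleO_irrefl (not_eventually.1 hne) hff

theorem hasFDerivAt_of_isLittleO_prod {X Y P : Type*} [NormedAddCommGroup X] [NormedSpace ℝ X]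
    [NormedAddCommGroup Y] [NormedSpace ℝ Y] [TopologicalSpace P] {f : P → X → Y} {A : X →L[ℝ] Y}
    {x₀ : X} {p₀ : P} {y₀ : Y} {s : Set X} {Λ : Set P} (hs : s ∈ 𝓝 x₀) (hp₀ : p₀ ∈ Λ)
    (hy₀ : y₀ = f p₀ x₀)
    (hf : (fun q : X × P => f q.2 q.1 - y₀ - A (q.1 - x₀)) =o[𝓝[s] x₀ ×ˢ 𝓝[Λ] p₀]
      fun q => q.1 - x₀) : HasFDerivAt (f p₀) A x₀ := by
  subst hy₀
  have hprod : Tendsto (fun x => (x, p₀)) (𝓝 x₀) (𝓝[s] x₀ ×ˢ 𝓝[Λ] p₀) := by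
    rw [nhdsWithin_eq_nhds.2 hs]
    exact tendsto_id.prodMk (tendsto_const_nhdsWithin hp₀)
  exact .of_isLittleO (hf.comp_tendsto hprod)

section

variable {n : ℕ} {T : ℝ} {Λ : Set ℝ} {Ω : Set (E n)} {F : ℝ → E n → ℝ → E n} {x₀ : G n T}
  {ρ : ℝ} {h ω h' ω' : ℝ → ℝ} {D : ℝ → E n → ℝ → E n →L[ℝ] E n} {lam₀ : ℝ}
  {A : ℝ → G n T →L[ℝ] G n T}

theorem CondB2.eq_Phi (hB2 : CondB2 Λ Ω F x₀ ρ) {lam : ℝ} (hlam : lam ∈ Λ) :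
    x₀ = Phi F lam x₀ :=
  (hB2.1 lam hlam).eq_Phi

theorem isLittleO_Phi_sub_sub (hT : 0 ≤ T) (hh : MonotoneOn h (Icc 0 T)) (hω : IsModulus ω)
    (hF : ∀ lam ∈ Λ, ClassF Ω T h ω (F lam)) (hB2 : CondB2 Λ Ω F x₀ ρ)
    (hFD : ∀ lam ∈ Λ, ∀ x ∈ Ω, ∀ t ∈ Icc 0 T, HasFDerivAt (fun y => F lam y t) (D lam x t) x)
    (hh' : MonotoneOn h' (Icc 0 T)) (hω' : IsModulus ω')
    (hD : ∀ lam ∈ Λ, ClassF Ω T h' ω' (D lam))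
    (hA : ∀ lam ∈ Λ, IsLinearization (D lam) x₀ (A lam))
    (hA₀ : Tendsto (fun lam => ‖A lam - A lam₀‖) (𝓝[Λ] lam₀) (𝓝 0)) :
    (fun p : G n T × ℝ => Phi F p.2 p.1 - x₀ - A lam₀ (p.1 - x₀))
      =o[𝓝[Metric.closedBall x₀ ρ] x₀ ×ˢ 𝓝[Λ] lam₀] fun p => p.1 - x₀ := by
  have hfst : Tendsto (fun p : G n T × ℝ => ‖p.1 - x₀‖)
      (𝓝[Metric.closedBall x₀ ρ] x₀ ×ˢ 𝓝[Λ] lam₀) (𝓝[≥] 0) :=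
    ((tendsto_norm_sub_self_nhdsGE x₀).mono_left nhdsWithin_le_nhds).comp tendsto_fst
  have hcoeff : Tendsto (fun p : G n T × ℝ => ω' ‖p.1 - x₀‖ * (h' T - h' 0) + ‖A p.2 - A lam₀‖)
      (𝓝[Metric.closedBall x₀ ρ] x₀ ×ˢ 𝓝[Λ] lam₀) (𝓝 0) := by
    have := ((hω'.tendsto_zero.comp hfst).mul_const (h' T - h' 0)).add (hA₀.comp tendsto_snd)
    rwa [zero_mul, add_zero] at this
  refine Asymptotics.isLittleO_iff.2 fun ε hε => ?_
  filter_upwards [hcoeff.eventually_le_const hε, prod_mem_prod self_mem_nhdsWithin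
    self_mem_nhdsWithin] with ⟨x, lam⟩ hle ⟨hx, hlam⟩
  have hrem := (hA lam hlam).norm_Phi_sub_sub_le hT (hF lam hlam) hh hω (hD lam hlam) hh' hω'
    (hFD lam hlam) hB2.2.2 hx
  rw [← hB2.eq_Phi hlam] at hrem
  calc ‖Phi F lam x - x₀ - A lam₀ (x - x₀)‖
      = ‖(Phi F lam x - x₀ - A lam (x - x₀)) + (A lam - A lam₀) (x - x₀)‖ := by
        rw [_root_.sub_apply, sub_add_sub_cancel]
    _ ≤ ω' ‖x - x₀‖ * (h' T - h' 0) * ‖x - x₀‖ + ‖A lam - A lam₀‖ * ‖x - x₀‖ :=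
        norm_add_le_of_le hrem (ContinuousLinearMap.le_opNorm _ _)
    _ = (ω' ‖x - x₀‖ * (h' T - h' 0) + ‖A lam - A lam₀‖) * ‖x - x₀‖ := (add_mul _ _ _).symm
    _ ≤ ε * ‖x - x₀‖ := mul_le_mul_of_nonneg_right hle (norm_nonneg _)

theorem eventually_solvesOp_imp_eq_of_isLittleO {A₀ : G n T →L[ℝ] G n T}
    (hiso : (ContinuousLinearMap.id ℝ (G n T) - A₀).IsInvertible)
    (hPhi : (fun p : G n T × ℝ => Phi F p.2 p.1 - x₀ - A₀ (p.1 - x₀))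
      =o[𝓝[Metric.closedBall x₀ ρ] x₀ ×ˢ 𝓝[Λ] lam₀] fun p => p.1 - x₀) :
    ∀ᶠ p : G n T × ℝ in 𝓝 (x₀, lam₀), SolvesOp F Λ x₀ ρ p.1 p.2 → p.1 = x₀ := by
  let S : Set (G n T × ℝ) := {p | SolvesOp F Λ x₀ ρ p.1 p.2}
  have hS : 𝓝[S] (x₀, lam₀) ≤ 𝓝[Metric.closedBall x₀ ρ] x₀ ×ˢ 𝓝[Λ] lam₀ := by
    rw [← nhdsWithin_prod_eq]
    exact nhdsWithin_mono _ fun p hp => ⟨hp.1, hp.2.1⟩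
  have hfix : (fun p : G n T × ℝ => (p.1 - x₀) - A₀ (p.1 - x₀)) =o[𝓝[S] (x₀, lam₀)]
      fun p => p.1 - x₀ := by
    refine (hPhi.mono hS).congr' ?_ .rfl
    filter_upwards [self_mem_nhdsWithin] with p hp
    rw [← hp.2.2]
  filter_upwards [eventually_nhdsWithin_iff.1 (eventuallyEq_zero_of_isLittleO hiso hfix)]
    with p hp hsol
  exact sub_eq_zero.1 (hp hsol)

theorem exists_forall_not_isBifurcationPoint
    (h : ∀ᶠ p : G n T × ℝ in 𝓝 (x₀, lam₀), SolvesOp F Λ x₀ ρ p.1 p.2 → p.1 = x₀) :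
    ∃ δ > 0, ∀ (x : G n T) (lam : ℝ), ‖x - x₀‖ + |lam - lam₀| < δ →
      ¬ IsBifurcationPoint F Λ x₀ ρ x lam := by
  obtain ⟨δ, hδ, hball⟩ := Metric.eventually_nhds_iff.1 (eventually_eventually_nhds.2 h)
  refine ⟨δ, hδ, fun x lam hlt ⟨hsol, hbif⟩ => ?_⟩
  have hev : ∀ᶠ p : G n T × ℝ in 𝓝 (x, lam), SolvesOp F Λ x₀ ρ p.1 p.2 → p.1 = x₀ := hball <| by
    rw [Prod.dist_eq, dist_eq_norm, Real.dist_eq]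
    exact (max_le_add_of_nonneg (norm_nonneg _) (abs_nonneg _)).trans_lt hlt
  obtain ⟨y, μ, hy, hysol, hyx⟩ := hbif _ hev
  exact hyx ((hy hysol).trans (hev.self_of_nhds hsol).symm)

end

end GenODE

open GenODE in
theorem mainTheorem2_general {n : ℕ} {T : ℝ} {Λ : Set ℝ} {Ω : Set (E n)} {F : ℝ → E n → ℝ → E n}
    {x₀ : G n T} {ρ : ℝ} {h ω h' ω' : ℝ → ℝ} {lam₀ : ℝ}
    (hT : 0 ≤ T) (hh : MonotoneOn h (Icc 0 T)) (hω : IsModulus ω)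
    (hF : ∀ lam ∈ Λ, ClassF Ω T h ω (F lam)) (hB2 : CondB2 Λ Ω F x₀ ρ)
    (hdiff : ∀ lam ∈ Λ, ∀ x ∈ Ω, ∀ t ∈ Icc 0 T, DifferentiableAt ℝ (fun y => F lam y t) x)
    (hh' : MonotoneOn h' (Icc 0 T)) (hω' : IsModulus ω')
    (hF' : ∀ lam ∈ Λ, ClassF Ω T h' ω' (jacobian F lam)) (hC3 : CondC3 T Λ Ω F)
    (hlam₀ : lam₀ ∈ Λ)
    (hiso : (ContinuousLinearMap.id ℝ (G n T) - fderiv ℝ (Phi F lam₀) x₀).IsInvertible) :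
    ∃ δ > 0, ∀ (x : G n T) (lam : ℝ), ‖x - x₀‖ + |lam - lam₀| < δ →
      ¬ IsBifurcationPoint F Λ x₀ ρ x lam := by
  let D := fun (lam : ℝ) (x : E n) (t : ℝ) => fderiv ℝ (fun y => F lam y t) x
  have hx₀ : ∀ t ∈ Icc 0 T, ev x₀ t ∈ Ω := fun t ht => ((hB2.1 lam₀ hlam₀).1 t ht).1
  obtain ⟨C, hC, hmatrix⟩ := exists_norm_matrixCLM_le n
  have hD : ∀ lam ∈ Λ, ClassF Ω T (fun t => C * h' t) ω' (D lam) := fun lam hlam => by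
    simpa only [LinearMap.toAddMonoidHom_coe, matrixCLM_jacobian]
      using (hF' lam hlam).map hC (matrixCLM n).toAddMonoidHom hmatrix
  have hDΛ : UniformInParameter Λ Ω T D := by
    simpa only [LinearMap.toAddMonoidHom_coe, matrixCLM_jacobian]
      using UniformInParameter.map hC (matrixCLM n).toAddMonoidHom hmatrix hC3
  have hCh' : MonotoneOn (fun t => C * h' t) (Icc 0 T) :=
    (monotone_mul_left_of_nonneg hC).comp_monotoneOn hh'
  choose! A hA using fun lam hlam => (hD lam hlam).exists_isLinearization hT hCh' hω' hx₀
  have hPhi := isLittleO_Phi_sub_sub hT hh hω hF hB2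
    (fun lam hlam x hx t ht => (hdiff lam hlam x hx t ht).hasFDerivAt) hCh' hω' hD hA
    (hDΛ.tendsto_norm_linearization_sub hT hx₀ hA hlam₀)
  rw [(hasFDerivAt_of_isLittleO_prod (Metric.closedBall_mem_nhds x₀ hB2.2.1) hlam₀
    (hB2.eq_Phi hlam₀) hPhi).fderiv] at hiso
  exact exists_forall_not_isBifurcationPoint
    (eventually_solvesOp_imp_eq_of_isLittleO hiso hPhi)

theorem mainTheorem2 (n : ℕ) (T : ℝ) (hT : 0 < T)
    (Λ : Set ℝ) (Ω : Set (GenODE.E n))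
    (F : ℝ → GenODE.E n → ℝ → GenODE.E n)
    (x₀ : GenODE.G n T) (ρ : ℝ)
    (hB1 : GenODE.CondB1 T Λ Ω F)
    (hB2 : GenODE.CondB2 Λ Ω F x₀ ρ)
    (hB3 : GenODE.CondB3 T Λ Ω F)
    (hC1 : GenODE.CondC1 T Λ Ω F)
    (hC3 : GenODE.CondC3 T Λ Ω F)
    (lam₀ : ℝ) (hlam₀ : lam₀ ∈ Λ)
    (hiso : (ContinuousLinearMap.id ℝ (GenODE.G n T) -
      fderiv ℝ (GenODE.Phi (T := T) F lam₀) x₀).IsInvertible) :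
    ∃ δ > 0, ∀ (x : GenODE.G n T) (lam : ℝ),
      ‖x - x₀‖ + |lam - lam₀| < δ →
        ¬ GenODE.IsBifurcationPoint F Λ x₀ ρ x lam := by
  obtain ⟨-, -, h, ω, hh, hω, hF⟩ := hB1
  obtain ⟨hdiff, -, h', ω', hh', -, hω', hF'⟩ := hC1
  exact mainTheorem2_general hT.le hh hω hF hB2 hdiff hh' hω' hF' hC3 hlam₀ hiso
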